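/- Let $U,V:\mathbb R\to\mathbb R$ be twice continuously differentiable with globally Lipschitz derivatives, and suppose that: (i) there is $\lambda>0$ with $(U'(x)-U'(y))(x-y)\ge\lambda|x-y|^2$ for all $x,y\in\mathbb R$; (ii) $V$ is even, $(V'(x)-V'(y))(x-y)\ge 0$ for all $x,y\in\mathbb R$, and there is $K_V>0$ with $|V''|\le K_V$ on $\mathbb R$. Let $\sigma\in\mathbb R$ and $p\ge 2$. Let $W$ be a standard one-dimensional Brownian motion and $\xi$ a real random variable independent of $W$ with $\mathbb E[|\xi|^p]<\infty$. For $N\ge 1$ let $(\xi^i,W^i)$, $i=1,\dots,N$, be i.i.d. copies of $(\xi,W)$, and let $(X^{1,N},\dots,X^{N,N})$ be the (continuous) solution of the interacting particle system $$X^{i,N}_t=\xi^i+\int_0^t B_i(X^{1,N}_s,\dots,X^{N,N}_s)\,ds+\sigma W^i_t,\quad t\ge 0,\qquad B_i(x)=-U'(x_i)-\frac1N\sum_{j=1}^N V'(x_i-x_j).$$ For $h>0$ and $M\in\mathbb N$ put $t_m=mh$, $T=t_M$, and define the non-Markovian Euler scheme by $X^{i,N,h}_{t_0}=\xi^i$ and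 $$X^{i,N,h}_{t_{m+1}}=X^{i,N,h}_{t_m}+B_i\big(X^{1,N,h}_{t_m},\dots,X^{N,N,h}_{t_m}\big)h+\frac\sigma2\big(\Delta W^i_m+\Delta W^i_{m+1}\big),\qquad 0\le m\le M-1,$$ where $\Delta W^i_0=0$ and $\Delta W^i_{m+1}=W^i_{t_{m+1}}-W^i_{t_m}$. Then the following hold, where all constants $\kappa,K,h_0$ depend only on $U,V,\lambda,K_V,\sigma,p$; in particular they are independent of $h,T,M,N$ (and of $\xi$). (1) There exist $\kappa,K,h_0>0$ such that for all $0<h<\min\{h_0,\tfrac1{2\lambda},1\}$, all $N\ge 1$, $M\in\mathbb N$ and $m\in\{0,\dots,M\}$, $$\max_{1\le i\le N}\mathbb E\big[|X^{i,N,h}_{t_m}|^p\big]\le K\big(1+\mathbb E[|\xi|^p]\,e^{-\kappa t_m}\big).$$ (2) There exist $K,h_0>0$ such that for all $0<h<\min\{h_0,\tfrac1{2\lambda},1\}$, all $N\ge 1$ and $M\in\mathbb N$, $$\max_{1\le i\le N}\ \max_{0\le m\le M}\mathbb E\big[|X^{i,N}_{t_m}-X^{i,N,h}_{t_m}|^2\big]\le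 K h\big(1+\mathbb E[|\xi|^2]\big).$$ In both parts the expectations on the left-hand side are finite. -/

import Mathlib

open MeasureTheory ProbabilityTheory
open scoped NNReal

noncomputable section

namespace ParticleSystem

/-- The standing assumption on the confining potential `U` and the interaction potential `V`
(both functions on the real line, so that the gradient is the derivative): both are `C²` with
globally Lipschitz gradient, `U` is uniformly convex with parameter `lam`, `V` is even and convex,
and the second derivative of `V` is bounded by `KV`. -/
structure Potentials (U V : ℝ → ℝ) (lam KV : ℝ) : Prop where
  contDiff_U : ContDiff ℝ 2 U
  contDiff_V : ContDiff ℝ 2 V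
  lipschitz_U : ∃ L : ℝ≥0, LipschitzWith L (deriv U)
  lipschitz_V : ∃ L : ℝ≥0, LipschitzWith L (deriv V)
  lam_pos : 0 < lam
  uniformly_convex_U : ∀ x y : ℝ, lam * |x - y| ^ 2 ≤ (deriv U x - deriv U y) * (x - y)
  even_V : ∀ x : ℝ, V (-x) = V x
  convex_V : ∀ x y : ℝ, 0 ≤ (deriv V x - deriv V y) * (x - y)
  KV_pos : 0 < KV
  bound_V : ∀ x : ℝ, |deriv (deriv V) x| ≤ KV

/-- The drift of the `N`-particle system:
`B_i(x) = - U'(x_i) - (1/N) ∑_j V'(x_i - x_j)`. -/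
def drift (U V : ℝ → ℝ) {N : ℕ} (x : Fin N → ℝ) (i : Fin N) : ℝ :=
  -deriv U (x i) - (1 / (N : ℝ)) * ∑ j, deriv V (x i - x j)

/-- `ξ` is a random variable and `W` is a standard one-dimensional Brownian motion with
continuous paths, independent of `ξ`. -/
structure IsInput {Ω : Type*} [MeasurableSpace Ω] (P : Measure Ω)
    (ξ : Ω → ℝ) (W : ℝ≥0 → Ω → ℝ) : Prop where
  measurable_init : Measurable ξ
  measurable_noise : ∀ t, Measurable (W t)
  brownian : IsBrownianReal W P
  indep : IndepFun ξ (fun ω t => W t ω) P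

/-- `(ξ^i, W^i)`, `i ∈ {1, …, N}`, on `(Ω, P)` are i.i.d. copies of the pair `(ξ, W)` on
`(Ω₀, P₀)`. Each `(ξ^i, W^i)` is asked to be an input pair itself, because the continuity of the
paths cannot be read off the law on the product space `ℝ × ℝ^[0,∞)`. -/
structure IsIIDCopies {Ω₀ : Type*} [MeasurableSpace Ω₀] (P₀ : Measure Ω₀)
    (ξ : Ω₀ → ℝ) (W : ℝ≥0 → Ω₀ → ℝ)
    {Ω : Type*} [MeasurableSpace Ω] (P : Measure Ω) {N : ℕ}
    (ξs : Fin N → Ω → ℝ) (Ws : Fin N → ℝ≥0 → Ω → ℝ) : Prop where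
  input : ∀ i, IsInput P (ξs i) (Ws i)
  identDistrib : ∀ i, IdentDistrib (fun ω => (ξs i ω, fun t => Ws i t ω))
    (fun ω => (ξ ω, fun t => W t ω)) P P₀
  indep : iIndepFun (fun i ω => (ξs i ω, fun t => Ws i t ω)) P

/-- `X` solves the interacting particle system driven by `(ξ^i, W^i)`: it is a process with
almost surely continuous paths such that almost surely, for all `i` and all `t ≥ 0`,
`X^i_t = ξ^i + ∫₀ᵗ B_i(X_s) ds + σ W^i_t`. -/
structure IsSolution (U V : ℝ → ℝ) (σ : ℝ)
    {Ω : Type*} [MeasurableSpace Ω] (P : Measure Ω) {N : ℕ}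
    (ξs : Fin N → Ω → ℝ) (Ws : Fin N → ℝ≥0 → Ω → ℝ) (X : Fin N → ℝ≥0 → Ω → ℝ) : Prop where
  aemeasurable : ∀ i t, AEMeasurable (X i t) P
  continuous : ∀ᵐ ω ∂P, ∀ i, Continuous (fun t => X i t ω)
  equation : ∀ᵐ ω ∂P, ∀ (i : Fin N) (t : ℝ≥0),
    X i t ω = ξs i ω + (∫ s in (0 : ℝ)..t, drift U V (fun j => X j s.toNNReal ω) i)
      + σ * Ws i t ω

/-- The grid point `t_m = m h`. -/
def gridTime (h : ℝ≥0) (m : ℕ) : ℝ≥0 := m * h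

/-- The increments `ΔW_0 = 0` and `ΔW_{m+1} = W_{t_{m+1}} - W_{t_m}`. -/
def increment {Ω : Type*} (h : ℝ≥0) (W : ℝ≥0 → Ω → ℝ) : ℕ → Ω → ℝ
  | 0 => fun _ => 0
  | m + 1 => fun ω => W (gridTime h (m + 1)) ω - W (gridTime h m) ω

/-- The non-Markovian Euler scheme:
`X_0 = ξ` and `X_{m+1} = X_m + B(X_m) h + (σ / 2) (ΔW_m + ΔW_{m+1})`. -/
def scheme (U V : ℝ → ℝ) (σ : ℝ) (h : ℝ≥0) {Ω : Type*} {N : ℕ}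
    (ξs : Fin N → Ω → ℝ) (Ws : Fin N → ℝ≥0 → Ω → ℝ) : ℕ → Fin N → Ω → ℝ
  | 0 => ξs
  | m + 1 => fun i ω =>
      scheme U V σ h ξs Ws m i ω
        + drift U V (fun j => scheme U V σ h ξs Ws m j ω) i * h
        + σ / 2 * (increment h (Ws i) m ω + increment h (Ws i) (m + 1) ω)

end ParticleSystem

end

/-!
The drift of the particle system is dissipative, uniformly in the number `N` of particles:
`B(x) - B(y)` is the linear operator `d ↦ -(uᵢ dᵢ + (1/N) ∑ⱼ gᵢⱼ (dᵢ - dⱼ))` applied to `d = x - y`,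
with `uᵢ ≥ lam` and a symmetric matrix `g` with entries in `[0, KV]`
(`Potentials.exists_dissipativeDrift`). The symmetric coupling cannot increase the average of
`|dⱼ|^p`, and particle `i` gains at most `KV` times this average from the others. Hence
`|dᵢ|^p + A · avg |dⱼ|^p` with `A = 2 KV / lam` decays exponentially (`lyap_dissipation`). This
gives bounds for each single particle, pathwise and with constants that do not depend on `N`. Both parts
reduce to this functional, because in both the noise can be made to cancel.

For the moments, the autoregression `O_{m+1} = (1 - h) O_m + (σ/2) (ΔW_m + ΔW_{m+1})` is subtracted
from the scheme. It is `σ` times the average of two consecutive values of a Markovian autoregression,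
which is Gaussian with variance at most one (`autoregression_hasLaw`), so that its moments are bounded. The
difference is an Euler scheme without noise, forced by the drift along `O`, and one step of it is a
convex combination to which Jensen's inequality applies (`lyap_step_le`).

For the strong error, `X_{t_m}` is compared with `X^h_m + (σ/2) ΔW_m`, which evolves by the full
increment `σ ΔW_{m+1}` and so has the same noise as the solution. The difference solves, between two
grid points and along an interpolation of the scheme, an ordinary differential equation
forced by the increments of the drift along that interpolation (`lyap_error_step_le`). These have
mean square of order `h` by the moment bound for the scheme, so no moments of `X` are needed, and
Grönwall's inequality (`BoundedMean.recursion`) gives a squared error of order `h`.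
-/

namespace ParticleSystem

section

/-! ### Averages over the particles -/

/-- The average `(1/N) ∑ⱼ xⱼ` over the particles. -/
noncomputable def avg {N : ℕ} (x : Fin N → ℝ) : ℝ := (1 / (N : ℝ)) * ∑ j, x j

/-- The functional `xᵢ + A · avg x`. The coupling makes particle `i` gain at most a multiple of
`avg x`, and `avg x` itself decays; a large weight `A` makes the sum decay. -/
noncomputable def lyap {N : ℕ} (A : ℝ) (x : Fin N → ℝ) (i : Fin N) : ℝ := x i + A * avg x

variable {N : ℕ} {A : ℝ} {x y : Fin N → ℝ}

lemma avg_mono (h : ∀ i, x i ≤ y i) : avg x ≤ avg y :=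
  mul_le_mul_of_nonneg_left (Finset.sum_le_sum fun i _ => h i) (by positivity)

lemma avg_nonneg (h : ∀ i, 0 ≤ x i) : 0 ≤ avg x :=
  mul_nonneg (by positivity) (Finset.sum_nonneg fun i _ => h i)

lemma avg_add (x y : Fin N → ℝ) : avg (fun i => x i + y i) = avg x + avg y := by
  simp only [avg, Finset.sum_add_distrib, mul_add]

lemma avg_mul_left (c : ℝ) (x : Fin N → ℝ) : avg (fun i => c * x i) = c * avg x := by
  simp only [avg, ← Finset.mul_sum]; ring

lemma avg_const (hN : 1 ≤ N) (c : ℝ) : avg (fun _ : Fin N => c) = c := by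
  have : (N : ℝ) ≠ 0 := by positivity
  simp [avg, this]

lemma abs_avg_le (x : Fin N → ℝ) : |avg x| ≤ avg fun i => |x i| := by
  rw [avg, abs_mul, abs_of_nonneg (by positivity : (0 : ℝ) ≤ 1 / N)]
  exact mul_le_mul_of_nonneg_left (Finset.abs_sum_le_sum_abs _ _) (by positivity)

/-- Jensen's inequality for the average over the particles. -/
lemma avg_rpow_le (hN : 1 ≤ N) (hx : ∀ i, 0 ≤ x i) {p : ℝ} (hp : 1 ≤ p) :
    avg x ^ p ≤ avg fun i => x i ^ p := by
  have hN' : (N : ℝ) ≠ 0 := by positivity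
  have := Real.rpow_arith_mean_le_arith_mean_rpow Finset.univ (fun _ : Fin N => 1 / (N : ℝ)) x
    (fun _ _ => by positivity) (by simp [hN']) (fun i _ => hx i) hp
  simpa [avg, Finset.mul_sum] using this

lemma lyap_mono (hA : 0 ≤ A) (h : ∀ i, x i ≤ y i) (i : Fin N) : lyap A x i ≤ lyap A y i :=
  add_le_add (h i) (mul_le_mul_of_nonneg_left (avg_mono h) hA)

lemma lyap_nonneg (hA : 0 ≤ A) (h : ∀ i, 0 ≤ x i) (i : Fin N) : 0 ≤ lyap A x i :=
  add_nonneg (h i) (mul_nonneg hA (avg_nonneg h))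

lemma le_lyap (hA : 0 ≤ A) (h : ∀ i, 0 ≤ x i) (i : Fin N) : x i ≤ lyap A x i :=
  le_add_of_nonneg_right (mul_nonneg hA (avg_nonneg h))

lemma lyap_add (A : ℝ) (x y : Fin N → ℝ) (i : Fin N) :
    lyap A (fun i => x i + y i) i = lyap A x i + lyap A y i := by
  simp only [lyap, avg_add]; ring

lemma lyap_mul_left (A c : ℝ) (x : Fin N → ℝ) (i : Fin N) :
    lyap A (fun i => c * x i) i = c * lyap A x i := by
  simp only [lyap, avg_mul_left]; ring

lemma continuous_lyap (A : ℝ) {f : Fin N → ℝ → ℝ} (hf : ∀ j, Continuous (f j)) (i : Fin N) :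
    Continuous fun t => lyap A (fun j => f j t) i := by
  simp only [lyap, avg]
  fun_prop

lemma integral_lyap (A : ℝ) {f : Fin N → ℝ → ℝ} (hf : ∀ j, Continuous (f j)) {a b : ℝ}
    (i : Fin N) :
    ∫ t in a..b, lyap A (fun j => f j t) i = lyap A (fun j => ∫ t in a..b, f j t) i := by
  have hi : ∀ j, IntervalIntegrable (f j) volume a b := fun j => (hf j).intervalIntegrable a b
  simp only [lyap, avg]
  rw [intervalIntegral.integral_add (hi i) (Continuous.intervalIntegrable (by fun_prop) a b),
    intervalIntegral.integral_const_mul, intervalIntegral.integral_const_mul,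
    intervalIntegral.integral_finsetSum fun j _ => hi j]

/-! ### Dissipativity of the drift -/

/-- The coefficients of a difference of drifts: the difference quotients `uᵢ` of `U'` lie in
`[lam, L]`, those of `V'` form a symmetric matrix `g` with entries in `[0, K]`. -/
structure Coefficients (lam L K : ℝ) (u : Fin N → ℝ) (g : Fin N → Fin N → ℝ) : Prop where
  le_u : ∀ i, lam ≤ u i
  u_le : ∀ i, u i ≤ L
  g_nonneg : ∀ i j, 0 ≤ g i j
  g_le : ∀ i j, g i j ≤ K
  symm : ∀ i j, g i j = g j i

/-- The linear operator `d ↦ uᵢ dᵢ + (1/N) ∑ⱼ gᵢⱼ (dᵢ - dⱼ)`. -/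
noncomputable def linop (u : Fin N → ℝ) (g : Fin N → Fin N → ℝ) (d : Fin N → ℝ) (i : Fin N) : ℝ :=
  u i * d i + avg fun j => g i j * (d i - d j)

/-- The symmetric coupling leaves the average unchanged, so the average decays at rate `lam`, and
the weight `2 K / lam` absorbs what the other particles contribute to particle `i`. -/
lemma lyap_dissipation {lam L K : ℝ} {u : Fin N → ℝ} {g : Fin N → Fin N → ℝ}
    (hlam : 0 < lam) (hc : Coefficients lam L K u g) {a : Fin N → ℝ} (ha : ∀ i, 0 ≤ a i)
    (i : Fin N) :
    lyap (2 * K / lam) (fun i => -lam * a i + avg fun j => g i j * (a j - a i)) i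
      ≤ -(lam / 2) * lyap (2 * K / lam) a i := by
  have h0 : avg (fun i => avg fun j => g i j * (a j - a i)) = 0 := by
    have h1 : ∑ i, ∑ j, g i j * (a j - a i) = 0 := by
      have h2 : ∑ i, ∑ j, g i j * (a j - a i) = -∑ i, ∑ j, g i j * (a j - a i) := by
        rw [← Finset.sum_neg_distrib, Finset.sum_comm]
        refine Finset.sum_congr rfl fun i _ => ?_
        rw [← Finset.sum_neg_distrib]
        refine Finset.sum_congr rfl fun j _ => ?_
        rw [hc.symm j i]; ring
      linarith
    simp only [avg, ← Finset.mul_sum, h1, mul_zero]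
  have h1 : (avg fun j => g i j * (a j - a i)) ≤ K * avg a := by
    rw [← avg_mul_left]
    refine avg_mono fun j => ?_
    nlinarith [hc.g_nonneg i j, hc.g_le i j, ha i, ha j, mul_nonneg (hc.g_nonneg i j) (ha i),
      mul_le_mul_of_nonneg_right (hc.g_le i j) (ha j)]
  simp only [lyap, avg_add, avg_mul_left, h0]
  have h2 : 2 * K / lam * lam = 2 * K := by field_simp
  have h3 := mul_nonneg hlam.le (ha i)
  nlinarith [avg_nonneg ha]

/-- The first-order form of a squared error: Young's inequality for the forcing, and
`2 dᵢ (dᵢ - dⱼ) ≥ dᵢ² - dⱼ²` for the coupling. -/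
lemma two_mul_linop_le {lam L K : ℝ} {u : Fin N → ℝ} {g : Fin N → Fin N → ℝ}
    (hlam : 0 < lam) (hc : Coefficients lam L K u g) (d : Fin N → ℝ) (i : Fin N) (r : ℝ) :
    2 * d i * (-linop u g d i + r)
      ≤ (-lam * d i ^ 2 + avg fun j => g i j * (d j ^ 2 - d i ^ 2)) + 1 / lam * r ^ 2 := by
  have h1 : (-2 * d i) * (avg fun j => g i j * (d i - d j))
      ≤ avg fun j => g i j * (d j ^ 2 - d i ^ 2) := by
    rw [← avg_mul_left]
    refine avg_mono fun j => ?_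
    nlinarith [mul_nonneg (hc.g_nonneg i j) (sq_nonneg (d i - d j))]
  have h2 : 2 * d i * r ≤ lam * d i ^ 2 + 1 / lam * r ^ 2 := by
    have : 0 ≤ lam * (d i - r / lam) ^ 2 := by positivity
    have h : lam * (d i - r / lam) ^ 2 = lam * d i ^ 2 - 2 * d i * r + 1 / lam * r ^ 2 := by
      field_simp; ring
    linarith
  have h3 := mul_le_mul_of_nonneg_right (hc.le_u i) (sq_nonneg (d i))
  simp only [linop]
  nlinarith

/-- One explicit Euler step of a forced linear dissipative system, in the `p`-th power: for small
`h` the new value is a convex combination of the old values and of `r / lam`. -/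
lemma abs_step_rpow_le (hN : 1 ≤ N) {lam L K : ℝ} {u : Fin N → ℝ} {g : Fin N → Fin N → ℝ}
    (hlam : 0 < lam) (hc : Coefficients lam L K u g) {p h : ℝ} (hp : 1 ≤ p) (hh : 0 ≤ h)
    (hhL : h * (L + K) ≤ 1) (d : Fin N → ℝ) (i : Fin N) (r : ℝ) :
    |d i + h * (-linop u g d i + r)| ^ p
      ≤ |d i| ^ p + h * ((-lam * |d i| ^ p + avg fun j => g i j * (|d j| ^ p - |d i| ^ p))
        + lam * (1 / lam) ^ p * |r| ^ p) := by
  set G : ℝ := avg fun j => g i j with hG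
  have hN' : (N : ℝ) ≠ 0 := by positivity
  have hG0 : 0 ≤ G := avg_nonneg fun j => hc.g_nonneg i j
  have hGK : G ≤ K := by
    rw [← avg_const hN K]; exact avg_mono fun j => hc.g_le i j
  have hw : 0 ≤ 1 - h * u i - h * G := by
    nlinarith [mul_le_mul_of_nonneg_left (add_le_add (hc.u_le i) hGK) hh]
  have hu := mul_le_mul_of_nonneg_left (hc.le_u i) hh
  let w : Option (Option (Fin N)) → ℝ
    | none => h * lam
    | some none => 1 - h * lam - h * G
    | some (some j) => h * (1 / (N : ℝ) * g i j)
  let z : Option (Option (Fin N)) → ℝ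
    | none => |r| / lam
    | some none => |d i|
    | some (some j) => |d j|
  have hw0 : ∀ k, 0 ≤ w k := by
    rintro (_ | _ | j)
    · exact mul_nonneg hh hlam.le
    · simp only [w]; linarith
    · exact mul_nonneg hh (mul_nonneg (by positivity) (hc.g_nonneg i j))
  have hz0 : ∀ k, 0 ≤ z k := by
    rintro (_ | _ | j) <;> simp only [z] <;> positivity
  have hsum : ∑ k, w k = 1 := by
    simp only [Fintype.sum_option, w, ← Finset.mul_sum]
    rw [hG, avg]; ring
  have key := Real.rpow_arith_mean_le_arith_mean_rpow Finset.univ w z (fun k _ => hw0 k) hsum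
    (fun k _ => hz0 k) hp
  simp only [Fintype.sum_option, w, z] at key
  have hsplit : ∀ q : Fin N → ℝ, ∑ j, h * (1 / (N : ℝ) * g i j) * q j
      = h * avg fun j => g i j * q j := by
    intro q
    simp only [avg, Finset.mul_sum]
    exact Finset.sum_congr rfl fun j _ => by ring
  have havg : ∀ q : Fin N → ℝ, ∀ c : ℝ, (avg fun j => g i j * (q j - c))
      = (avg fun j => g i j * q j) - G * c := by
    intro q c
    have : (fun j => g i j * (q j - c)) = fun j => g i j * q j + (-c) * g i j := by
      funext j; ring
    rw [this, avg_add, avg_mul_left]; ring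
  rw [hsplit, hsplit] at key
  have hlin : d i + h * (-linop u g d i + r)
      = h * r + ((1 - h * u i - h * G) * d i + h * avg fun j => g i j * d j) := by
    have : (fun j => g i j * (d i - d j)) = fun j => (-1) * (g i j * (d j - d i)) := by
      funext j; ring
    rw [linop, this, avg_mul_left, havg]; ring
  have hle : |d i + h * (-linop u g d i + r)|
      ≤ h * lam * (|r| / lam) + ((1 - h * lam - h * G) * |d i|
        + h * avg fun j => g i j * |d j|) := by
    rw [hlin]
    refine (abs_add_le _ _).trans (add_le_add ?_ ((abs_add_le _ _).trans (add_le_add ?_ ?_)))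
    · rw [abs_mul, abs_of_nonneg hh]
      apply le_of_eq; field_simp
    · rw [abs_mul, abs_of_nonneg hw]
      exact mul_le_mul_of_nonneg_right (by linarith) (abs_nonneg _)
    · rw [abs_mul, abs_of_nonneg hh]
      refine mul_le_mul_of_nonneg_left ((abs_avg_le _).trans (avg_mono fun j => ?_)) hh
      rw [abs_mul, abs_of_nonneg (hc.g_nonneg i j)]
  refine (Real.rpow_le_rpow (abs_nonneg _) hle (by linarith)).trans (key.trans (le_of_eq ?_))
  rw [havg (fun j => |d j| ^ p), div_eq_mul_one_div, Real.mul_rpow (abs_nonneg _) (by positivity)]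
  ring

/-- One explicit Euler step contracts the functional up to the forcing. -/
lemma lyap_step_le (hN : 1 ≤ N) {lam L K : ℝ} {u : Fin N → ℝ} {g : Fin N → Fin N → ℝ}
    (hlam : 0 < lam) (hK : 0 ≤ K) (hc : Coefficients lam L K u g) {p h : ℝ} (hp : 1 ≤ p)
    (hh : 0 ≤ h) (hhL : h * (L + K) ≤ 1) (d r : Fin N → ℝ) (i : Fin N) :
    lyap (2 * K / lam) (fun j => |d j + h * (-linop u g d j + r j)| ^ p) i
      ≤ (1 - lam / 2 * h) * lyap (2 * K / lam) (fun j => |d j| ^ p) i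
        + h * (lam * (1 / lam) ^ p * lyap (2 * K / lam) (fun j => |r j| ^ p) i) := by
  refine (lyap_mono (by positivity)
    (fun j => abs_step_rpow_le hN hlam hc hp hh hhL d j (r j)) i).trans ?_
  rw [lyap_add, lyap_mul_left, lyap_add, lyap_mul_left]
  have := lyap_dissipation hlam hc (a := fun j => |d j| ^ p) (fun j => by positivity) i
  nlinarith [mul_le_mul_of_nonneg_left this hh]

/-- The continuous-time counterpart of `lyap_step_le`, for the squared error: Grönwall's
inequality on `[a, b]` for a forced linear dissipative differential equation. -/
lemma lyap_ode_le {lam L K : ℝ} (hlam : 0 < lam) (hK : 0 ≤ K) {a b : ℝ} (hab : a ≤ b)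
    {e e' r : Fin N → ℝ → ℝ} (he : ∀ i t, HasDerivAt (e i) (e' i t) t)
    (he' : ∀ i, Continuous (e' i)) (hr : ∀ i, Continuous (r i))
    (heq : ∀ t ∈ Set.Icc a b, ∃ u g, Coefficients lam L K u g ∧
      ∀ i, e' i t = -linop u g (fun j => e j t) i + r i t) (i : Fin N) :
    lyap (2 * K / lam) (fun j => e j b ^ 2) i
      ≤ Real.exp (-(lam / 2 * (b - a))) * lyap (2 * K / lam) (fun j => e j a ^ 2) i
        + 1 / lam * lyap (2 * K / lam) (fun j => ∫ t in a..b, r j t ^ 2) i := by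
  set A := 2 * K / lam with hA
  have hA0 : 0 ≤ A := by positivity
  have hec : ∀ i, Continuous (e i) := fun i =>
    continuous_iff_continuousAt.2 fun t => (he i t).continuousAt
  have hcont : ∀ f : Fin N → ℝ → ℝ, (∀ i, Continuous (f i)) →
      Continuous fun t => lyap A (fun j => f j t) i := fun f hf => continuous_lyap A hf i
  have hderiv : ∀ t, HasDerivAt (fun t => lyap A (fun j => e j t ^ 2) i)
      (lyap A (fun j => 2 * e j t * e' j t) i) t := by
    intro t
    have h1 : ∀ j, HasDerivAt (fun t => e j t ^ 2) (2 * e j t * e' j t) t := fun j => by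
      simpa using (he j t).fun_pow 2
    simp only [lyap, avg]
    exact (h1 i).add (((HasDerivAt.fun_sum fun j _ => h1 j).const_mul _).const_mul _)
  have hexp : ∀ t, HasDerivAt (fun t => Real.exp (lam / 2 * t))
      (Real.exp (lam / 2 * t) * (lam / 2)) t := fun t => by
    simpa using ((hasDerivAt_id t).const_mul (lam / 2)).exp
  have hint := intervalIntegral.integral_eq_sub_of_hasDerivAt (a := a) (b := b)
    (fun t _ => (hexp t).mul (hderiv t))
    (Continuous.intervalIntegrable (by
      have h1 := hcont (fun j t => 2 * e j t * e' j t) (fun j => by fun_prop)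
      have h2 := hcont (fun j t => e j t ^ 2) (fun j => by fun_prop)
      fun_prop) a b)
  have hbound := intervalIntegral.integral_mono_on hab
    (Continuous.intervalIntegrable (μ := volume)
      (u := fun t => Real.exp (lam / 2 * t) * (lam / 2) * lyap A (fun j => e j t ^ 2) i
        + Real.exp (lam / 2 * t) * lyap A (fun j => 2 * e j t * e' j t) i) (by
      have h1 := hcont (fun j t => 2 * e j t * e' j t) (fun j => by fun_prop)
      have h2 := hcont (fun j t => e j t ^ 2) (fun j => by fun_prop)
      fun_prop) a b)
    (Continuous.intervalIntegrable (μ := volume)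
      (u := fun t => Real.exp (lam / 2 * b) * (1 / lam) * lyap A (fun j => r j t ^ 2) i) (by
      have h1 := hcont (fun j t => r j t ^ 2) (fun j => by fun_prop)
      fun_prop) a b)
    (fun t ht => by
      obtain ⟨u, g, hc, hug⟩ := heq t ht
      have h1 : lyap A (fun j => 2 * e j t * e' j t) i
          ≤ -(lam / 2) * lyap A (fun j => e j t ^ 2) i
            + 1 / lam * lyap A (fun j => r j t ^ 2) i := by
        have h2 := lyap_mono hA0 (fun j =>
          (congrArg (2 * e j t * ·) (hug j)).le.trans
            (two_mul_linop_le hlam hc (fun j => e j t) j (r j t))) i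
        rw [lyap_add, lyap_mul_left] at h2
        exact h2.trans (add_le_add_left
          (lyap_dissipation hlam hc (fun j => sq_nonneg (e j t)) i) _)
      have h3 : Real.exp (lam / 2 * t) ≤ Real.exp (lam / 2 * b) := by
        apply Real.exp_le_exp.2; nlinarith [ht.2]
      have h4 : 0 ≤ 1 / lam * lyap A (fun j => r j t ^ 2) i :=
        mul_nonneg (by positivity) (lyap_nonneg hA0 (fun j => sq_nonneg _) i)
      nlinarith [mul_le_mul_of_nonneg_left h1 (Real.exp_pos (lam / 2 * t)).le,
        mul_le_mul_of_nonneg_right h3 h4])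
  rw [intervalIntegral.integral_const_mul, integral_lyap A fun j => (hr j).fun_pow 2] at hbound
  simp only [Pi.mul_apply] at hint
  rw [hint] at hbound
  have hE : Real.exp (-(lam / 2 * (b - a))) = Real.exp (lam / 2 * a) / Real.exp (lam / 2 * b) := by
    rw [← Real.exp_sub]; congr 1; ring
  have hb := Real.exp_pos (lam / 2 * b)
  rw [hE]
  have := (div_le_div_iff_of_pos_right hb).2 (sub_le_iff_le_add.1 hbound)
  rw [mul_div_cancel_left₀ _ hb.ne'] at this
  refine this.trans (le_of_eq ?_)
  field_simp
  ring

end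

section

variable {N : ℕ} {A : ℝ}

lemma deriv_neg_of_even {V : ℝ → ℝ} (hV : ∀ x, V (-x) = V x) (x : ℝ) :
    deriv V (-x) = -deriv V x := by
  have h := deriv_comp_neg V x
  rw [show (fun x => V (-x)) = V from funext hV] at h
  linarith

/-- Differences of the drift are given by a linear operator with coefficients in the ranges of
`Coefficients`, for every number of particles. -/
def DissipativeDrift (U V : ℝ → ℝ) (lam L K : ℝ) : Prop :=
  ∀ (N : ℕ) (x y : Fin N → ℝ), ∃ u g, Coefficients lam L K u g ∧
    ∀ i, drift U V x i - drift U V y i = -linop u g (fun j => x j - y j) i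

lemma Potentials.exists_dissipativeDrift {U V : ℝ → ℝ} {lam KV : ℝ}
    (hUV : Potentials U V lam KV) : ∃ L : ℝ, 0 ≤ L ∧ DissipativeDrift U V lam L KV := by
  obtain ⟨L, hL⟩ := hUV.lipschitz_U
  have hLU : ∀ a b, |deriv U a - deriv U b| ≤ L * |a - b| := fun a b => by
    simpa [Real.dist_eq] using hL.dist_le_mul a b
  have hlamL : lam ≤ L := by
    have h1 := hUV.uniformly_convex_U 1 0
    have h2 := hLU 1 0
    simp only [sub_zero, abs_one, mul_one, one_pow] at h1 h2
    exact h1.trans ((le_abs_self _).trans h2)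
  have hlipV : LipschitzWith ⟨KV, hUV.KV_pos.le⟩ (deriv V) :=
    lipschitzWith_of_nnnorm_deriv_le hUV.contDiff_V.differentiable_deriv_two
      fun x => hUV.bound_V x
  have hLV : ∀ a b, |deriv V a - deriv V b| ≤ KV * |a - b| := fun a b =>
    hlipV.dist_le_mul a b
  have hodd := deriv_neg_of_even hUV.even_V
  refine ⟨L, L.2, fun N x y => ⟨fun i => if x i = y i then lam else
    (deriv U (x i) - deriv U (y i)) / (x i - y i),
    fun i j => slope (deriv V) (y i - y j) (x i - x j), ⟨?_, ?_, ?_, ?_, ?_⟩, ?_⟩⟩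
  · intro i
    split_ifs with h
    · exact le_rfl
    · have h1 := hUV.uniformly_convex_U (x i) (y i)
      have h2 : 0 < (x i - y i) ^ 2 := by have := sub_ne_zero.2 h; positivity
      rw [sq_abs] at h1
      rw [show (deriv U (x i) - deriv U (y i)) / (x i - y i)
        = (deriv U (x i) - deriv U (y i)) * (x i - y i) / (x i - y i) ^ 2 by
          have := sub_ne_zero.2 h; field_simp, le_div_iff₀ h2]
      exact h1
  · intro i
    split_ifs with h
    · exact hlamL
    · refine (le_abs_self _).trans ?_
      rw [abs_div, div_le_iff₀ (abs_pos.2 (sub_ne_zero.2 h))]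
      exact hLU _ _
  · intro i j
    rw [slope_def_field]
    have := hUV.convex_V (x i - x j) (y i - y j)
    rcases eq_or_ne (x i - x j) (y i - y j) with h | h
    · simp [h]
    · rw [show (deriv V (x i - x j) - deriv V (y i - y j)) / (x i - x j - (y i - y j))
        = (deriv V (x i - x j) - deriv V (y i - y j)) * (x i - x j - (y i - y j))
          / (x i - x j - (y i - y j)) ^ 2 by have := sub_ne_zero.2 h; field_simp]
      positivity
  · intro i j
    rw [slope_def_field]
    refine (le_abs_self _).trans ?_
    rw [abs_div]
    exact div_le_of_le_mul₀ (abs_nonneg _) hUV.KV_pos.le (hLV _ _)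
  · intro i j
    rw [slope_def_field, slope_def_field, ← neg_sub (x i) (x j), ← neg_sub (y i) (y j), hodd, hodd,
      ← neg_div_neg_eq]
    congr 1 <;> ring
  · intro i
    have h1 : (if x i = y i then lam else (deriv U (x i) - deriv U (y i)) / (x i - y i))
        * (x i - y i) = deriv U (x i) - deriv U (y i) := by
      split_ifs with h
      · simp [h]
      · exact div_mul_cancel₀ _ (sub_ne_zero.2 h)
    have h2 : ∀ j, slope (deriv V) (y i - y j) (x i - x j) * (x i - y i - (x j - y j))
        = deriv V (x i - x j) + (-1) * deriv V (y i - y j) := by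
      intro j
      rw [slope_def_field, show x i - y i - (x j - y j) = x i - x j - (y i - y j) by ring]
      rcases eq_or_ne (x i - x j) (y i - y j) with h | h
      · simp [h]
      · rw [div_mul_cancel₀ _ (sub_ne_zero.2 h)]; ring
    simp only [linop, h1, h2, avg_add, avg_mul_left]
    simp only [drift, avg]
    ring

lemma abs_linop_le {lam L K : ℝ} {u : Fin N → ℝ} {g : Fin N → Fin N → ℝ}
    (hlam : 0 < lam) (hN : 1 ≤ N) (hc : Coefficients lam L K u g) (d : Fin N → ℝ) (i : Fin N) :
    |linop u g d i| ≤ (L + K) * lyap 1 (fun j => |d j|) i := by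
  have h1 : |u i * d i| ≤ L * |d i| := by
    rw [abs_mul, abs_of_pos (hlam.trans_le (hc.le_u i))]
    exact mul_le_mul_of_nonneg_right (hc.u_le i) (abs_nonneg _)
  have h2 : |avg fun j => g i j * (d i - d j)| ≤ K * (|d i| + avg fun j => |d j|) := by
    refine (abs_avg_le _).trans ?_
    rw [← avg_const hN |d i|, ← avg_add, ← avg_mul_left]
    refine avg_mono fun j => ?_
    rw [abs_mul, abs_of_nonneg (hc.g_nonneg i j)]
    exact mul_le_mul (hc.g_le i j) (abs_sub _ _) (abs_nonneg _)
      ((hc.g_nonneg i j).trans (hc.g_le i j))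
  have h3 : 0 ≤ L * avg fun j => |d j| :=
    mul_nonneg (hlam.le.trans ((hc.le_u i).trans (hc.u_le i))) (avg_nonneg fun j => abs_nonneg _)
  rw [linop, lyap]
  refine (abs_add_le _ _).trans ?_
  nlinarith

lemma abs_add_rpow_le (x y : ℝ) {p : ℝ} (hp : 1 ≤ p) :
    |x + y| ^ p ≤ 2 ^ (p - 1) * (|x| ^ p + |y| ^ p) := by
  have h : (|x| + |y|) ^ p ≤ 2 ^ (p - 1) * (|x| ^ p + |y| ^ p) := by
    exact_mod_cast NNReal.rpow_add_le_mul_rpow_add_rpow ⟨|x|, abs_nonneg x⟩ ⟨|y|, abs_nonneg y⟩ hp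
  exact (Real.rpow_le_rpow (abs_nonneg _) (abs_add_le x y) (by linarith)).trans h

lemma lyap_one_abs_rpow_le (hN : 1 ≤ N) {p : ℝ} (hp : 1 ≤ p) (d : Fin N → ℝ) (i : Fin N) :
    lyap 1 (fun j => |d j|) i ^ p ≤ 2 ^ (p - 1) * lyap 1 (fun j => |d j| ^ p) i := by
  have h0 : 0 ≤ avg fun j => |d j| := avg_nonneg fun j => abs_nonneg _
  have h := abs_add_rpow_le |d i| (avg fun j => |d j|) hp
  rw [abs_of_nonneg (by positivity), abs_abs, abs_of_nonneg h0] at h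
  simp only [lyap, one_mul]
  refine h.trans ?_
  gcongr
  exact avg_rpow_le hN (fun j => abs_nonneg _) hp

lemma abs_linop_rpow_le {lam L K : ℝ} {u : Fin N → ℝ} {g : Fin N → Fin N → ℝ}
    (hlam : 0 < lam) (hN : 1 ≤ N) (hL : 0 ≤ L) (hK : 0 ≤ K) (hc : Coefficients lam L K u g)
    {p : ℝ} (hp : 1 ≤ p) (d : Fin N → ℝ) (i : Fin N) :
    |linop u g d i| ^ p ≤ (L + K) ^ p * 2 ^ (p - 1) * lyap 1 (fun j => |d j| ^ p) i := by
  refine (Real.rpow_le_rpow (abs_nonneg _) (abs_linop_le hlam hN hc d i) (by linarith)).trans ?_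
  rw [Real.mul_rpow (by positivity) (lyap_nonneg zero_le_one (fun j => abs_nonneg _) i), mul_assoc]
  exact mul_le_mul_of_nonneg_left (lyap_one_abs_rpow_le hN hp d i) (by positivity)

lemma drift_zero {U V : ℝ → ℝ} (hV : ∀ x, V (-x) = V x) (i : Fin N) :
    drift U V (fun _ => 0) i = -deriv U 0 := by
  have h : deriv V 0 = 0 := by
    have := deriv_neg_of_even hV 0
    rw [neg_zero] at this
    linarith
  simp [drift, h]

lemma continuous_drift {U V : ℝ → ℝ} {lam KV : ℝ} (hUV : Potentials U V lam KV) (i : Fin N) :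
    Continuous fun x : Fin N → ℝ => drift U V x i := by
  have h1 : Continuous (deriv U) := hUV.lipschitz_U.choose_spec.continuous
  have h2 : Continuous (deriv V) := hUV.lipschitz_V.choose_spec.continuous
  simp only [drift]
  fun_prop

lemma DissipativeDrift.abs_sub_rpow_le {U V : ℝ → ℝ} {lam L K : ℝ}
    (hD : DissipativeDrift U V lam L K) (hlam : 0 < lam) (hL : 0 ≤ L) (hK : 0 ≤ K) (hN : 1 ≤ N)
    {p : ℝ} (hp : 1 ≤ p) (x y : Fin N → ℝ) (i : Fin N) :
    |drift U V x i - drift U V y i| ^ p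
      ≤ (L + K) ^ p * 2 ^ (p - 1) * lyap 1 (fun j => |x j - y j| ^ p) i := by
  obtain ⟨u, g, hc, h⟩ := hD N x y
  rw [h, abs_neg]
  exact abs_linop_rpow_le hlam hN hL hK hc hp _ i

lemma DissipativeDrift.abs_rpow_le {U V : ℝ → ℝ} {lam L K : ℝ} (hV : ∀ x, V (-x) = V x)
    (hD : DissipativeDrift U V lam L K) (hlam : 0 < lam) (hL : 0 ≤ L) (hK : 0 ≤ K) (hN : 1 ≤ N)
    {p : ℝ} (hp : 1 ≤ p) (x : Fin N → ℝ) (i : Fin N) :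
    |drift U V x i| ^ p ≤ 2 ^ (p - 1)
      * ((L + K) ^ p * 2 ^ (p - 1) * lyap 1 (fun j => |x j| ^ p) i + |deriv U 0| ^ p) := by
  have h1 := hD.abs_sub_rpow_le hlam hL hK hN hp x (fun _ => 0) i
  have h2 := abs_add_rpow_le (drift U V x i - drift U V (fun _ => 0) i)
    (drift U V (fun _ => 0) i) hp
  rw [sub_add_cancel] at h2
  refine h2.trans ?_
  rw [drift_zero hV, abs_neg] at *
  simp only [sub_zero] at h1
  gcongr

/-! ### Bounded means -/

variable {Ω : Type*} [MeasurableSpace Ω] {P : Measure Ω}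

/-- `f` is integrable with mean at most `c`. -/
def BoundedMean (P : Measure Ω) (f : Ω → ℝ) (c : ℝ) : Prop := Integrable f P ∧ ∫ ω, f ω ∂P ≤ c

lemma BoundedMean.le {f : Ω → ℝ} {c c' : ℝ} (h : BoundedMean P f c) (hc : c ≤ c') :
    BoundedMean P f c' := ⟨h.1, h.2.trans hc⟩

lemma BoundedMean.add {f g : Ω → ℝ} {c d : ℝ} (hf : BoundedMean P f c) (hg : BoundedMean P g d) :
    BoundedMean P (fun ω => f ω + g ω) (c + d) :=
  ⟨hf.1.add hg.1, (integral_add hf.1 hg.1).le.trans (add_le_add hf.2 hg.2)⟩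

lemma BoundedMean.const_mul {f : Ω → ℝ} {c a : ℝ} (hf : BoundedMean P f c) (ha : 0 ≤ a) :
    BoundedMean P (fun ω => a * f ω) (a * c) :=
  ⟨hf.1.const_mul a, (integral_const_mul a f).le.trans (mul_le_mul_of_nonneg_left hf.2 ha)⟩

lemma BoundedMean.const [IsProbabilityMeasure P] (c : ℝ) : BoundedMean P (fun _ => c) c :=
  ⟨integrable_const c, by simp⟩

lemma BoundedMean.mono {f g : Ω → ℝ} {c : ℝ} (hg : BoundedMean P g c)
    (hf : AEStronglyMeasurable f P) (h0 : ∀ ω, 0 ≤ f ω) (hfg : ∀ᵐ ω ∂P, f ω ≤ g ω) :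
    BoundedMean P f c := by
  have hi : Integrable f P := hg.1.mono' hf (by
    filter_upwards [hfg] with ω h
    rwa [Real.norm_of_nonneg (h0 ω)])
  exact ⟨hi, (integral_mono_ae hi hg.1 hfg).trans hg.2⟩

lemma BoundedMean.lyap (hN : 1 ≤ N) (hA : 0 ≤ A) {f : Fin N → Ω → ℝ} {c : ℝ}
    (hf : ∀ j, BoundedMean P (f j) c) (i : Fin N) :
    BoundedMean P (fun ω => lyap A (fun j => f j ω) i) ((1 + A) * c) := by
  have h1 : BoundedMean P (fun ω => ∑ j, f j ω) (∑ _j : Fin N, c) :=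
    ⟨integrable_finsetSum _ fun j _ => (hf j).1, by
      rw [integral_finsetSum _ fun j _ => (hf j).1]
      exact Finset.sum_le_sum fun j _ => (hf j).2⟩
  have h2 : BoundedMean P (fun ω => avg fun j => f j ω) c := by
    have := h1.const_mul (a := 1 / (N : ℝ)) (by positivity)
    have hc := avg_const hN c
    rw [avg] at hc
    rwa [hc] at this
  have := (hf i).add (h2.const_mul hA)
  rwa [show c + A * c = (1 + A) * c by ring] at this

/-- Discrete Grönwall inequality in mean. Integrability is propagated together with the bound. -/
lemma BoundedMean.recursion {φ G : ℕ → Ω → ℝ} {κ h c₀ C : ℝ} (hκ : 0 < κ) (hh : 0 ≤ h)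
    (hκh : κ * h ≤ 1) (hC : 0 ≤ C) (hφ : ∀ m, AEStronglyMeasurable (φ m) P)
    (hφ0 : ∀ m ω, 0 ≤ φ m ω) (h0 : BoundedMean P (φ 0) c₀) (hG : ∀ m, BoundedMean P (G m) C)
    (step : ∀ m, ∀ᵐ ω ∂P, φ (m + 1) ω ≤ (1 - κ * h) * φ m ω + h * G m ω) (m : ℕ) :
    BoundedMean P (φ m) ((1 - κ * h) ^ m * c₀ + C / κ) := by
  induction m with
  | zero =>
    have : 0 ≤ C / κ := by positivity
    exact h0.le (by linarith)
  | succ m ih =>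
    refine BoundedMean.mono (((ih.const_mul (a := 1 - κ * h) (by linarith)).add
      ((hG m).const_mul hh)).le (le_of_eq ?_)) (hφ _) (hφ0 _) (step m)
    field_simp
    ring

/-! ### Moments of the noise -/

lemma boundedMean_gaussian_rpow {X : Ω → ℝ} {v : ℝ≥0} (hX : HasLaw X (gaussianReal 0 v) P)
    (hv : v ≤ 1) {p : ℝ} (hp : 1 ≤ p) :
    BoundedMean P (fun ω => |X ω| ^ p) (∫ z, |z| ^ p ∂gaussianReal 0 1) := by
  have hi : ∀ w : ℝ≥0, Integrable (fun z : ℝ => |z| ^ p) (gaussianReal 0 w) := fun w => by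
    have := (memLp_id_gaussianReal' (μ := 0) (v := w) (ENNReal.ofReal p)
      (by simp)).integrable_norm_rpow (by simp; linarith) (by simp)
    simpa [ENNReal.toReal_ofReal (by linarith : 0 ≤ p)] using this
  have hXi : Integrable ((fun z : ℝ => |z| ^ p) ∘ X) P := by
    refine Integrable.comp_aemeasurable ?_ hX.aemeasurable
    rw [hX.map_eq]; exact hi v
  refine ⟨hXi, ?_⟩
  have h1 : ∫ ω, |X ω| ^ p ∂P = ∫ z, |z| ^ p ∂gaussianReal 0 v :=
    hX.integral_comp (f := fun z : ℝ => |z| ^ p) (hi v).aestronglyMeasurable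
  have hlaw : HasLaw (fun z : ℝ => √(v : ℝ) * z) (gaussianReal 0 v) (gaussianReal 0 1) := by
    have h := gaussianReal_const_mul (HasLaw.id (μ := gaussianReal 0 1)) (√(v : ℝ))
    have hv' : (NNReal.mk (√(v : ℝ) ^ 2) (sq_nonneg _)) * 1 = v := by
      ext; simp
    rw [mul_zero, hv'] at h
    simpa using h
  have h2 : ∫ z, |√(v : ℝ) * z| ^ p ∂gaussianReal 0 1 = ∫ z, |z| ^ p ∂gaussianReal 0 v :=
    hlaw.integral_comp (f := fun z : ℝ => |z| ^ p) (hi v).aestronglyMeasurable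
  rw [h1, ← h2]
  refine integral_mono_of_nonneg (Filter.Eventually.of_forall fun z => by positivity) (hi 1)
    (Filter.Eventually.of_forall fun z => ?_)
  refine Real.rpow_le_rpow (abs_nonneg _) ?_ (by linarith)
  rw [abs_mul, abs_of_nonneg (Real.sqrt_nonneg _)]
  refine mul_le_of_le_one_left (abs_nonneg _) ?_
  exact Real.sqrt_le_one.2 (by exact_mod_cast hv)

lemma boundedMean_sub_sq {W : ℝ≥0 → Ω → ℝ} (hW : IsPreBrownianReal W P) {s t : ℝ≥0} (hst : s ≤ t) :
    BoundedMean P (fun ω => (W t ω - W s ω) ^ 2) (t - s) := by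
  have hlaw := hW.hasLaw_sub t s
  have : IsProbabilityMeasure P := hlaw.isProbabilityMeasure
  have hmem : MemLp (W t - W s) 2 P := hlaw.hasGaussianLaw.memLp_two
  refine ⟨hmem.integrable_sq, ?_⟩
  have h1 := hlaw.variance_eq
  rw [variance_of_integral_eq_zero hlaw.aemeasurable
    (by rw [hlaw.integral_eq, integral_id_gaussianReal]), variance_id_gaussianReal] at h1
  refine (show ∫ ω, (W t ω - W s ω) ^ 2 ∂P = _ from h1).le.trans (le_of_eq ?_)
  rw [coe_nndist, Real.dist_eq, abs_of_nonneg (sub_nonneg.2 (by exact_mod_cast hst))]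
  rfl

/-- The first-order autoregression `P_{m+1} = (1 - h) P_m + (W_{t_{m+1}} - W_{t_m})`, `P_0 = 0`. -/
noncomputable def autoregression (h : ℝ≥0) (W : ℝ≥0 → Ω → ℝ) : ℕ → Ω → ℝ
  | 0 => fun _ => 0
  | m + 1 => fun ω => (1 - (h : ℝ)) * autoregression h W m ω + increment h W (m + 1) ω

lemma gridTime_mono (h : ℝ≥0) (m : ℕ) : gridTime h m ≤ gridTime h (m + 1) := by
  simp only [gridTime]; gcongr; simp

lemma coe_gridTime_succ (h : ℝ≥0) (m : ℕ) :
    (gridTime h (m + 1) : ℝ) = gridTime h m + h := by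
  simp only [gridTime]; push_cast; ring

/-- The value at step `m` depends only on the path up to `t_m`. -/
lemma autoregression_eq_comp {Ω : Type*} (h : ℝ≥0) (W : ℝ≥0 → Ω → ℝ) (m : ℕ) :
    ∃ F : (Set.Iic (gridTime h m) → ℝ) → ℝ, Measurable F ∧
      autoregression h W m = F ∘ fun ω t => W t ω := by
  induction m with
  | zero => exact ⟨fun _ => 0, measurable_const, rfl⟩
  | succ m ih =>
    obtain ⟨F, hF, hFe⟩ := ih
    have hle := gridTime_mono h m
    refine ⟨fun x => (1 - (h : ℝ)) * F (fun t => x ⟨t, le_trans t.2 hle⟩)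
      + (x ⟨gridTime h (m + 1), Set.mem_Iic.2 le_rfl⟩ - x ⟨gridTime h m, hle⟩), ?_, ?_⟩
    · refine Measurable.add (Measurable.const_mul (hF.comp ?_) _) (by fun_prop)
      exact measurable_pi_lambda _ fun t => measurable_pi_apply _
    · funext ω
      simp only [autoregression, hFe, Function.comp, increment]

lemma autoregression_hasLaw {h : ℝ≥0} (hh : h ≤ 1) {W : ℝ≥0 → Ω → ℝ} (hW : IsPreBrownianReal W P)
    (m : ℕ) : ∃ v ≤ (1 : ℝ≥0), HasLaw (autoregression h W m) (gaussianReal 0 v) P := by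
  have : IsProbabilityMeasure P := (hW.hasLaw_eval 0).isProbabilityMeasure
  induction m with
  | zero =>
    refine ⟨0, zero_le_one, ?_⟩
    rw [gaussianReal_zero_var]
    exact hasLaw_dirac_of_ae_eq (Filter.Eventually.of_forall fun _ => rfl)
  | succ m ih =>
    obtain ⟨v, hv, hlaw⟩ := ih
    obtain ⟨F, hF, hFe⟩ := autoregression_eq_comp h W m
    have hinc := hW.hasLaw_sub (gridTime h (m + 1)) (gridTime h m)
    have hd : nndist (gridTime h (m + 1)).1 (gridTime h m).1 = h := by
      ext
      rw [coe_nndist, Real.dist_eq]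
      have := coe_gridTime_succ h m
      change |(gridTime h (m + 1) : ℝ) - gridTime h m| = h
      rw [this, add_sub_cancel_left]
      exact abs_of_nonneg h.2
    rw [hd] at hinc
    have hind : IndepFun (fun ω => (1 - (h : ℝ)) * autoregression h W m ω)
        (W (gridTime h (m + 1)) - W (gridTime h m)) P := by
      have hev : Measurable fun y : ℝ≥0 → ℝ => y h := measurable_pi_apply h
      have h1 := (hW.indepFun_shift (gridTime h m)).symm.comp
        (φ := fun x => (1 - (h : ℝ)) * F x) (hF.const_mul _) hev
      have h2 : (fun x => (1 - (h : ℝ)) * F x) ∘ (fun ω (t : Set.Iic (gridTime h m)) => W t ω)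
          = fun ω => (1 - (h : ℝ)) * autoregression h W m ω := by
        rw [hFe]; rfl
      have h3 : ((fun y : ℝ≥0 → ℝ => y h) ∘
          fun ω t => W (gridTime h m + t) ω - W (gridTime h m) ω)
          = W (gridTime h (m + 1)) - W (gridTime h m) := by
        have : gridTime h m + h = gridTime h (m + 1) := by
          ext; rw [coe_gridTime_succ]; rfl
        funext ω
        simp [this]
      rwa [h2, h3] at h1
    have hsum := hind.hasLaw_fun_add (gaussianReal_const_mul hlaw (1 - (h : ℝ))) hinc
    rw [gaussianReal_conv_gaussianReal, mul_zero, add_zero] at hsum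
    refine ⟨_, ?_, hsum⟩
    rw [← NNReal.coe_le_coe]
    have hh' : (h : ℝ) ≤ 1 := by exact_mod_cast hh
    have hv' : (v : ℝ) ≤ 1 := by exact_mod_cast hv
    have h0 : (0 : ℝ) ≤ h := h.2
    change (1 - (h : ℝ)) ^ 2 * v + h ≤ 1
    nlinarith [mul_le_mul_of_nonneg_left hv' (sq_nonneg (1 - (h : ℝ)))]

/-- The autoregression driven by the noise of the scheme,
`O_{m+1} = (1 - h) O_m + (σ / 2) (ΔW_m + ΔW_{m+1})`: a discrete Ornstein–Uhlenbeck process. -/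
noncomputable def schemeNoise (σ : ℝ) (h : ℝ≥0) (W : ℝ≥0 → Ω → ℝ) : ℕ → Ω → ℝ
  | 0 => fun _ => 0
  | m + 1 => fun ω => (1 - (h : ℝ)) * schemeNoise σ h W m ω
      + σ / 2 * (increment h W m ω + increment h W (m + 1) ω)

/-- The non-Markovian noise is `σ` times the average of two consecutive values of a Markovian
autoregression. -/
lemma schemeNoise_succ {Ω : Type*} (σ : ℝ) (h : ℝ≥0) (W : ℝ≥0 → Ω → ℝ) (m : ℕ) (ω : Ω) :
    schemeNoise σ h W (m + 1) ω
      = σ / 2 * (autoregression h W (m + 1) ω + autoregression h W m ω) := by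
  induction m with
  | zero => simp [schemeNoise, autoregression, increment]
  | succ m ih =>
    unfold schemeNoise
    simp only [ih, autoregression]
    ring

lemma measurable_increment {h : ℝ≥0} {W : ℝ≥0 → Ω → ℝ} (hW : ∀ t, Measurable (W t)) (m : ℕ) :
    Measurable (increment h W m) := by
  cases m with
  | zero => exact measurable_const
  | succ m => exact (hW _).sub (hW _)

lemma measurable_schemeNoise {σ : ℝ} {h : ℝ≥0} {W : ℝ≥0 → Ω → ℝ} (hW : ∀ t, Measurable (W t))
    (m : ℕ) : Measurable (schemeNoise σ h W m) := by
  induction m with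
  | zero => exact measurable_const
  | succ m ih =>
    have h1 := measurable_increment (h := h) hW m
    have h2 := measurable_increment (h := h) hW (m + 1)
    simp only [schemeNoise]
    fun_prop

lemma boundedMean_schemeNoise {p : ℝ} (hp : 1 ≤ p) (σ : ℝ) {h : ℝ≥0} (hh : h ≤ 1)
    {W : ℝ≥0 → Ω → ℝ} (hWm : ∀ t, Measurable (W t)) (hW : IsPreBrownianReal W P) (m : ℕ) :
    BoundedMean P (fun ω => |schemeNoise σ h W m ω| ^ p)
      (|σ / 2| ^ p * (2 ^ (p - 1) * (2 * ∫ z, |z| ^ p ∂gaussianReal 0 1))) := by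
  have : IsProbabilityMeasure P := (hW.hasLaw_eval 0).isProbabilityMeasure
  have hc : 0 ≤ ∫ z : ℝ, |z| ^ p ∂gaussianReal 0 1 := integral_nonneg fun z => by positivity
  cases m with
  | zero =>
    refine (BoundedMean.const (P := P) 0).le (by positivity) |>.mono
      (by simp only [schemeNoise]; exact aestronglyMeasurable_const) (fun ω => by positivity) ?_
    simp [schemeNoise, Real.zero_rpow (by linarith : p ≠ 0)]
  | succ m =>
    obtain ⟨v, hv, h1⟩ := autoregression_hasLaw hh hW m
    obtain ⟨v', hv', h2⟩ := autoregression_hasLaw hh hW (m + 1)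
    rw [two_mul]
    refine ((((boundedMean_gaussian_rpow h2 hv' hp).add
      (boundedMean_gaussian_rpow h1 hv hp)).const_mul (a := 2 ^ (p - 1)) (by positivity)).const_mul
        (a := |σ / 2| ^ p) (by positivity)).mono ?_ (fun ω => by positivity) ?_
    · have := measurable_schemeNoise (σ := σ) (h := h) hWm (m + 1)
      exact Measurable.aestronglyMeasurable (by fun_prop)
    · refine Filter.Eventually.of_forall fun ω => ?_
      rw [schemeNoise_succ, abs_mul, Real.mul_rpow (abs_nonneg _) (abs_nonneg _)]
      exact mul_le_mul_of_nonneg_left (abs_add_rpow_le _ _ hp) (by positivity)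

/-- The squared increments of Brownian motion, integrated over a time interval of length `h`, have
mean at most `h²`. The integral is taken along an everywhere continuous modification, which is
jointly measurable. -/
lemma exists_boundedMean_integral_sq {W : ℝ≥0 → Ω → ℝ} (hWm : ∀ t, Measurable (W t))
    (hW : IsBrownianReal W P) {a b : ℝ≥0} (hab : a ≤ b) :
    ∃ R : Ω → ℝ, BoundedMean P R ((b - a : ℝ) ^ 2) ∧
      ∀ᵐ ω ∂P, ∫ t in (a : ℝ)..b, (W t.toNNReal ω - W a ω) ^ 2 = R ω := by
  have : IsProbabilityMeasure P := (hW.hasLaw_eval 0).isProbabilityMeasure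
  obtain ⟨S, hS, hSm, hS1⟩ := (hW.cont).exists_measurable_mem
  classical
  let W' : ℝ≥0 → Ω → ℝ := fun t => S.indicator (W t)
  have hW'm : ∀ t, Measurable (W' t) := fun t => (hWm t).indicator hSm
  have hW'c : ∀ ω, Continuous fun t => W' t ω := by
    intro ω
    by_cases h : ω ∈ S
    · simpa [W', h] using hS1 ω h
    · simpa [W', h] using continuous_const
  have hae : ∀ᵐ ω ∂P, ∀ t, W' t ω = W t ω := by
    filter_upwards [hS] with ω h t
    simp [W', h]
  let f : ℝ → Ω → ℝ := fun t ω => (W' t.toNNReal ω - W' a ω) ^ 2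
  have hf : Measurable (Function.uncurry f) := by
    refine measurable_uncurry_of_continuous_of_measurable (fun ω => ?_) (fun t => ?_)
    · have h1 := hW'c ω
      have h2 : Continuous Real.toNNReal := continuous_real_toNNReal
      exact ((h1.comp h2).sub continuous_const).pow 2
    · exact ((hW'm _).sub (hW'm _)).pow_const 2
  have hbm : ∀ t ∈ Set.Ioc (a : ℝ) b, BoundedMean P (f t) (b - a) := by
    intro t ht
    have ha : a ≤ t.toNNReal := by
      rw [← NNReal.coe_le_coe, Real.coe_toNNReal t (a.2.trans ht.1.le)]; exact ht.1.le
    refine (boundedMean_sub_sq hW.toIsPreBrownianReal ha).le ?_ |>.mono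
      (((hW'm _).sub (hW'm _)).pow_const 2).aestronglyMeasurable (fun ω => sq_nonneg _) ?_
    · rw [Real.coe_toNNReal t (a.2.trans ht.1.le)]; linarith [ht.2]
    · filter_upwards [hae] with ω h
      simp [f, h]
  have hfin : IsFiniteMeasure (volume.restrict (Set.Ioc (a : ℝ) b)) := inferInstance
  have hint : Integrable (Function.uncurry f) ((volume.restrict (Set.Ioc (a : ℝ) b)).prod P) := by
    rw [integrable_prod_iff hf.aestronglyMeasurable]
    constructor
    · filter_upwards [ae_restrict_mem measurableSet_Ioc] with t ht using (hbm t ht).1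
    · refine Integrable.mono' (integrable_const (b - a : ℝ)) ?_ ?_
      · exact (hf.norm.stronglyMeasurable.integral_prod_right).aestronglyMeasurable
      · filter_upwards [ae_restrict_mem measurableSet_Ioc] with t ht
        rw [Real.norm_of_nonneg (integral_nonneg fun ω => norm_nonneg _)]
        refine (le_of_eq (integral_congr_ae (Filter.Eventually.of_forall fun ω => ?_))).trans
          (hbm t ht).2
        exact Real.norm_of_nonneg (sq_nonneg _)
  have hab' : (a : ℝ) ≤ b := by exact_mod_cast hab
  refine ⟨fun ω => ∫ t in (a : ℝ)..b, f t ω, ⟨?_, ?_⟩, ?_⟩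
  · simp only [intervalIntegral.integral_of_le hab']
    exact hint.integral_prod_right
  · simp only [intervalIntegral.integral_of_le hab']
    rw [← integral_integral_swap hint]
    refine (setIntegral_mono_on hint.integral_prod_left (integrable_const (b - a : ℝ))
      measurableSet_Ioc fun t ht => (hbm t ht).2).trans (le_of_eq ?_)
    simp [hab']
    ring
  · filter_upwards [hae] with ω h
    simp [f, h]

end

section

variable {N : ℕ} {U V : ℝ → ℝ} {lam L KV : ℝ}

/-! ### Moment bounds for the scheme -/

lemma measurable_scheme (hUV : Potentials U V lam KV) {σ : ℝ} {h : ℝ≥0}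
    {Ω : Type*} [MeasurableSpace Ω] {ξs : Fin N → Ω → ℝ} {Ws : Fin N → ℝ≥0 → Ω → ℝ}
    (hξ : ∀ i, Measurable (ξs i)) (hW : ∀ i t, Measurable (Ws i t)) (m : ℕ) (i : Fin N) :
    Measurable (scheme U V σ h ξs Ws m i) := by
  induction m generalizing i with
  | zero => exact hξ i
  | succ m ih =>
    have h1 : Measurable fun ω => drift U V (fun j => scheme U V σ h ξs Ws m j ω) i :=
      (continuous_drift hUV i).measurable.comp (measurable_pi_lambda _ ih)
    have h2 := measurable_increment (h := h) (hW i) m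
    have h3 := measurable_increment (h := h) (hW i) (m + 1)
    have h4 := ih i
    simp only [scheme]
    fun_prop

/-- Subtracting `schemeNoise` from the scheme leaves a recursion without noise, forced by the drift
along `schemeNoise`. -/
lemma scheme_sub_schemeNoise_succ {σ : ℝ} {h : ℝ≥0} {Ω : Type*} {ξs : Fin N → Ω → ℝ}
    {Ws : Fin N → ℝ≥0 → Ω → ℝ} {u : Fin N → ℝ} {g : Fin N → Fin N → ℝ} {m : ℕ} {ω : Ω}
    (hd : ∀ i, drift U V (fun j => scheme U V σ h ξs Ws m j ω) i
        - drift U V (fun j => schemeNoise σ h (Ws j) m ω) i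
      = -linop u g (fun j => scheme U V σ h ξs Ws m j ω - schemeNoise σ h (Ws j) m ω) i)
    (i : Fin N) :
    scheme U V σ h ξs Ws (m + 1) i ω - schemeNoise σ h (Ws i) (m + 1) ω
      = (scheme U V σ h ξs Ws m i ω - schemeNoise σ h (Ws i) m ω)
        + h * (-linop u g (fun j => scheme U V σ h ξs Ws m j ω - schemeNoise σ h (Ws j) m ω) i
          + (drift U V (fun j => schemeNoise σ h (Ws j) m ω) i + schemeNoise σ h (Ws i) m ω)) := by
  rw [← hd]
  simp only [scheme, schemeNoise]
  ring

lemma one_sub_pow_le_exp {κ : ℝ} {h : ℝ≥0} (hκh : κ * h ≤ 1) (m : ℕ) :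
    (1 - κ * h) ^ m ≤ Real.exp (-κ * (gridTime h m : ℝ)) := by
  have h1 : 1 - κ * h ≤ Real.exp (-(κ * h)) := by
    have := Real.add_one_le_exp (-(κ * h)); linarith
  refine (pow_le_pow_left₀ (by linarith) h1 m).trans (le_of_eq ?_)
  rw [← Real.exp_nat_mul]
  congr 1
  simp only [gridTime]
  push_cast
  ring

/-- Uniform moment bounds for the scheme, for initial values with a common bound `M₀` on the
`p`-th moments. The threshold for `h` makes one Euler step a convex combination. -/
theorem exists_boundedMean_scheme (hUV : Potentials U V lam KV) (σ : ℝ) {p : ℝ} (hp : 1 ≤ p) :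
    ∃ κ K h₀ : ℝ, 0 < κ ∧ 0 < K ∧ 0 < h₀ ∧
      ∀ {Ω : Type*} [MeasurableSpace Ω] (P : Measure Ω) [IsProbabilityMeasure P] {N : ℕ},
      1 ≤ N → ∀ {ξs : Fin N → Ω → ℝ} {Ws : Fin N → ℝ≥0 → Ω → ℝ},
      (∀ i, Measurable (ξs i)) → (∀ i t, Measurable (Ws i t)) →
      (∀ i, IsPreBrownianReal (Ws i) P) → ∀ {M₀ : ℝ}, 0 ≤ M₀ →
      (∀ i, BoundedMean P (fun ω => |ξs i ω| ^ p) M₀) →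
      ∀ {h : ℝ≥0}, (h : ℝ) < h₀ → h ≤ 1 → lam * h ≤ 1 / 2 → ∀ m i,
        BoundedMean P (fun ω => |scheme U V σ h ξs Ws m i ω| ^ p)
          (K * (1 + M₀ * Real.exp (-κ * (gridTime h m : ℝ)))) := by
  obtain ⟨L, hL, hD⟩ := hUV.exists_dissipativeDrift
  have hlam := hUV.lam_pos
  have hKV := hUV.KV_pos
  set A := 2 * KV / lam with hA
  have hA0 : 0 ≤ A := by positivity
  set CO : ℝ := |σ / 2| ^ p * (2 ^ (p - 1) * (2 * ∫ z, |z| ^ p ∂gaussianReal 0 1)) with hCO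
  have hCO0 : 0 ≤ CO := by
    have hc : 0 ≤ ∫ z : ℝ, |z| ^ p ∂gaussianReal 0 1 := integral_nonneg fun z => by positivity
    positivity
  -- the bounds for the mean of the `p`-th power of the forcing, and of the source of `lyap`
  set Cr : ℝ := 2 ^ (p - 1) * (2 ^ (p - 1)
    * ((L + KV) ^ p * 2 ^ (p - 1) * ((1 + 1) * CO) + |deriv U 0| ^ p) + CO) with hCr
  set C : ℝ := lam * (1 / lam) ^ p * ((1 + A) * Cr) with hC
  have hC0 : 0 ≤ C := by positivity
  refine ⟨lam / 2, 2 ^ (p - 1) * ((1 + A) + C / (lam / 2) + CO), 1 / (L + KV), by positivity,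
    by positivity, by positivity, ?_⟩
  intro Ω _ P _ N hN ξs Ws hξm hWm hW M₀ hM₀ hξ h hh hh1 hlamh m i
  have hh0 : (0 : ℝ) ≤ h := h.2
  have hhL : (h : ℝ) * (L + KV) ≤ 1 := by
    rw [lt_div_iff₀ (by positivity)] at hh
    exact hh.le
  have hO : ∀ m j, BoundedMean P (fun ω => |schemeNoise σ h (Ws j) m ω| ^ p) CO := fun m j =>
    boundedMean_schemeNoise hp σ hh1 (hWm j) (hW j) m
  have hOm : ∀ m j, Measurable (schemeNoise σ h (Ws j) m) := fun m j =>
    measurable_schemeNoise (hWm j) m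
  have hSm := measurable_scheme hUV (σ := σ) (h := h) hξm hWm
  let r : ℕ → Fin N → Ω → ℝ := fun m j ω =>
    drift U V (fun k => schemeNoise σ h (Ws k) m ω) j + schemeNoise σ h (Ws j) m ω
  have hr : ∀ m j, BoundedMean P (fun ω => |r m j ω| ^ p) Cr := by
    intro m j
    refine ((((((BoundedMean.lyap hN zero_le_one (hO m) j).const_mul
      (a := (L + KV) ^ p * 2 ^ (p - 1)) (by positivity)).add
      (BoundedMean.const (|deriv U 0| ^ p))).const_mul (a := 2 ^ (p - 1)) (by positivity)).add
      (hO m j)).const_mul (a := 2 ^ (p - 1)) (by positivity)).mono ?_ (fun ω => by positivity)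
      (Filter.Eventually.of_forall fun ω => ?_)
    · have h1 : Measurable fun ω => drift U V (fun k => schemeNoise σ h (Ws k) m ω) j :=
        (continuous_drift hUV j).measurable.comp (measurable_pi_lambda _ (hOm m))
      have h2 := hOm m j
      exact Measurable.aestronglyMeasurable (by fun_prop)
    · refine (abs_add_rpow_le _ _ hp).trans ?_
      gcongr
      exact hD.abs_rpow_le hUV.even_V hlam hL hKV.le hN hp _ j
  let D : ℕ → Fin N → Ω → ℝ := fun m j ω =>
    scheme U V σ h ξs Ws m j ω - schemeNoise σ h (Ws j) m ω
  have hDm : ∀ m j, Measurable (D m j) := fun m j => (hSm m j).sub (hOm m j)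
  have hφ := BoundedMean.recursion (P := P) (φ := fun m ω => lyap A (fun j => |D m j ω| ^ p) i)
    (G := fun m ω => lam * (1 / lam) ^ p * lyap A (fun j => |r m j ω| ^ p) i)
    (κ := lam / 2) (h := h) (c₀ := (1 + A) * M₀) (C := C) (by positivity) hh0 (by linarith) hC0
    (fun m => by
      have := hDm m
      simp only [lyap, avg]
      exact Measurable.aestronglyMeasurable (by fun_prop))
    (fun m ω => lyap_nonneg hA0 (fun j => by positivity) i)
    (BoundedMean.lyap hN hA0 (fun j => by simpa [D, scheme, schemeNoise] using hξ j) i)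
    (fun m => (BoundedMean.lyap hN hA0 (hr m) i).const_mul (by positivity))
    (fun m => Filter.Eventually.of_forall fun ω => by
      obtain ⟨u, g, hc, hug⟩ := hD N (fun j => scheme U V σ h ξs Ws m j ω)
        (fun j => schemeNoise σ h (Ws j) m ω)
      have h1 : ∀ j, D (m + 1) j ω
          = D m j ω + h * (-linop u g (fun k => D m k ω) j + r m j ω) :=
        scheme_sub_schemeNoise_succ hug
      simp only [h1]
      exact lyap_step_le hN hlam hKV.le hc hp hh0 hhL _ _ i) m
  refine ((hφ.add (hO m i)).const_mul (a := 2 ^ (p - 1)) (by positivity)).le ?_ |>.mono ?_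
    (fun ω => by positivity) (Filter.Eventually.of_forall fun ω => ?_)
  · have h1 := one_sub_pow_le_exp (κ := lam / 2) (h := h) (by linarith) m
    have h2 : (1 - lam / 2 * h) ^ m * ((1 + A) * M₀)
        ≤ Real.exp (-(lam / 2) * (gridTime h m : ℝ)) * ((1 + A) * M₀) := by gcongr
    have h3 : 0 ≤ (C / (lam / 2) + CO) * (M₀ * Real.exp (-(lam / 2) * (gridTime h m : ℝ))) := by
      positivity
    rw [mul_assoc]
    refine mul_le_mul_of_nonneg_left ?_ (by positivity)
    nlinarith
  · have := hSm m i
    exact Measurable.aestronglyMeasurable (by fun_prop)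
  · have h1 := abs_add_rpow_le (D m i ω) (schemeNoise σ h (Ws i) m ω) hp
    rw [show D m i ω + schemeNoise σ h (Ws i) m ω = scheme U V σ h ξs Ws m i ω from
      sub_add_cancel _ _] at h1
    refine h1.trans ?_
    gcongr
    exact le_lyap hA0 (x := fun j => |D m j ω| ^ p) (fun j => by positivity) i

/-! ### The strong error -/

/-- The pathwise error over one time step `[a, b]`. The Euler step starts at `z + δ` with the drift
frozen at `z`; the noise increment is the same for the solution `x` and for the Euler step, so
their difference solves a differential equation without noise, forced by the drift increments along
the interpolated Euler step. -/
lemma lyap_error_step_le (hUV : Potentials U V lam KV) (hL : 0 ≤ L)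
    (hD : DissipativeDrift U V lam L KV) (hN : 1 ≤ N) {a b σ : ℝ} (hab : a ≤ b)
    {x w : Fin N → ℝ → ℝ} (hx : ∀ j, Continuous (x j)) (hw : ∀ j, Continuous (w j))
    (z δ : Fin N → ℝ)
    (heq : ∀ t ∈ Set.Icc a b, ∀ j,
      x j t = x j a + (∫ s in a..t, drift U V (fun k => x k s) j) + σ * (w j t - w j a))
    (i : Fin N) :
    lyap (2 * KV / lam)
        (fun j => (x j b - (z j + δ j + (b - a) * drift U V z j + σ * (w j b - w j a))) ^ 2) i
      ≤ Real.exp (-(lam / 2 * (b - a)))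
          * lyap (2 * KV / lam) (fun j => (x j a - (z j + δ j)) ^ 2) i
        + 1 / lam * lyap (2 * KV / lam) (fun j => (L + KV) ^ 2 * 2 * lyap 1 (fun k =>
          3 * ((b - a) * (δ k ^ 2 + (b - a) ^ 2 * drift U V z k ^ 2)
            + σ ^ 2 * ∫ t in a..b, (w k t - w k a) ^ 2)) j) i := by
  have hlam := hUV.lam_pos
  have hKV := hUV.KV_pos.le
  have hdc : ∀ j, Continuous fun s => drift U V (fun k => x k s) j := fun j =>
    (continuous_drift hUV j).comp (continuous_pi hx)
  let e' : Fin N → ℝ → ℝ := fun j t => drift U V (fun k => x k t) j - drift U V z j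
  let e : Fin N → ℝ → ℝ := fun j t => x j a - (z j + δ j) + ∫ s in a..t, e' j s
  let r : Fin N → ℝ → ℝ := fun j t => drift U V (fun k => x k t - e k t) j - drift U V z j
  have he' : ∀ j, Continuous (e' j) := fun j => (hdc j).sub continuous_const
  have he : ∀ j t, HasDerivAt (e j) (e' j t) t := fun j t =>
    (intervalIntegral.integral_hasDerivAt_right ((he' j).intervalIntegrable a t)
      (he' j).aestronglyMeasurable.stronglyMeasurableAtFilter
      (he' j).continuousAt).const_add _
  have hec : ∀ j, Continuous (e j) := fun j =>
    continuous_iff_continuousAt.2 fun t => (he j t).continuousAt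
  have hr : ∀ j, Continuous (r j) := fun j =>
    ((continuous_drift hUV j).comp
      (continuous_pi fun k => (hx k).sub (hec k))).sub continuous_const
  have hxe : ∀ t ∈ Set.Icc a b, ∀ j, e j t
      = x j t - (z j + δ j + (t - a) * drift U V z j + σ * (w j t - w j a)) := by
    intro t ht j
    simp only [e, e']
    rw [intervalIntegral.integral_sub ((hdc j).intervalIntegrable _ _)
      (continuous_const.intervalIntegrable _ _), intervalIntegral.integral_const, heq t ht j]
    simp only [smul_eq_mul]
    ring
  have hmain := lyap_ode_le hlam hKV hab he he' hr (L := L) (fun t _ => by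
    obtain ⟨u, g, hc, hug⟩ := hD N (fun k => x k t) (fun k => x k t - e k t)
    refine ⟨u, g, hc, fun j => ?_⟩
    have h1 := hug j
    simp only [sub_sub_cancel] at h1
    rw [← h1]
    simp only [e', r]
    ring) i
  have hea : ∀ j, e j a = x j a - (z j + δ j) := fun j => by simp [e]
  simp only [hxe b (Set.right_mem_Icc.2 hab), hea] at hmain
  refine hmain.trans (add_le_add_right (mul_le_mul_of_nonneg_left
    (lyap_mono (by positivity) (fun j => ?_) i) (by positivity)) _)
  -- the forcing is bounded pointwise by the squared distance of the interpolation from `z`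
  let B : Fin N → ℝ → ℝ := fun k t =>
    3 * (δ k ^ 2 + (b - a) ^ 2 * drift U V z k ^ 2 + σ ^ 2 * (w k t - w k a) ^ 2)
  have hB : ∀ k, Continuous (B k) := fun k => by
    have := hw k
    simp only [B]; fun_prop
  have hrB : ∀ t ∈ Set.Icc a b, r j t ^ 2
      ≤ (L + KV) ^ 2 * 2 * lyap 1 (fun k => B k t) j := by
    intro t ht
    have h1 := hD.abs_sub_rpow_le hlam hL hKV hN one_le_two (fun k => x k t - e k t) z j
    rw [show (2 : ℝ) - 1 = 1 by norm_num, Real.rpow_one] at h1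
    simp only [Real.rpow_two, sq_abs] at h1
    refine h1.trans (mul_le_mul_of_nonneg_left (lyap_mono zero_le_one (fun k => ?_) j)
      (by positivity))
    rw [hxe t ht k]
    have h2 : ((t - a) * drift U V z k) ^ 2 ≤ (b - a) ^ 2 * drift U V z k ^ 2 := by
      rw [mul_pow]
      have := ht.1
      have := ht.2
      gcongr
    have h3 : x k t - (x k t - (z k + δ k + (t - a) * drift U V z k + σ * (w k t - w k a))) - z k
        = δ k + (t - a) * drift U V z k + σ * (w k t - w k a) := by ring
    rw [h3]
    simp only [B]
    nlinarith [sq_nonneg (δ k - (t - a) * drift U V z k),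
      sq_nonneg (δ k - σ * (w k t - w k a)),
      sq_nonneg ((t - a) * drift U V z k - σ * (w k t - w k a))]
  have hint := intervalIntegral.integral_mono_on hab
    (((hr j).fun_pow 2).intervalIntegrable (μ := volume) a b)
    ((continuous_const.fun_mul (continuous_lyap 1 hB j)).intervalIntegrable a b) hrB
  rw [intervalIntegral.integral_const_mul, integral_lyap 1 hB] at hint
  refine hint.trans (le_of_eq ?_)
  congr 2
  funext k
  have hwc := hw k
  simp only [B]
  rw [intervalIntegral.integral_const_mul, intervalIntegral.integral_add
    (continuous_const.intervalIntegrable _ _)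
    (Continuous.intervalIntegrable (by fun_prop) _ _), intervalIntegral.integral_const,
    intervalIntegral.integral_const_mul, smul_eq_mul]

lemma boundedMean_increment_sq {Ω : Type*} [MeasurableSpace Ω] {P : Measure Ω}
    {W : ℝ≥0 → Ω → ℝ} (hW : IsPreBrownianReal W P) (h : ℝ≥0) (m : ℕ) :
    BoundedMean P (fun ω => increment h W m ω ^ 2) h := by
  have : IsProbabilityMeasure P := (hW.hasLaw_eval 0).isProbabilityMeasure
  cases m with
  | zero => simpa [increment] using (BoundedMean.const (P := P) 0).le h.2
  | succ m =>
    have := boundedMean_sub_sq hW (gridTime_mono h m)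
    rwa [coe_gridTime_succ, add_sub_cancel_left] at this

lemma sq_add_mul_le {x l : ℝ} (hx : x ^ 2 ≤ l) (y v : ℝ) :
    (x + y * v) ^ 2 ≤ 2 * l + 2 * y ^ 2 * v ^ 2 := by
  nlinarith [sq_nonneg (x - y * v)]

/-- Uniform mean-square error of the scheme, for initial values with a common bound `M₀` on the
second moments. -/
theorem exists_boundedMean_error (hUV : Potentials U V lam KV) (σ : ℝ) :
    ∃ K h₀ : ℝ, 0 < K ∧ 0 < h₀ ∧
      ∀ {Ω : Type*} [MeasurableSpace Ω] (P : Measure Ω) [IsProbabilityMeasure P] {N : ℕ},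
      1 ≤ N → ∀ {ξs : Fin N → Ω → ℝ} {Ws : Fin N → ℝ≥0 → Ω → ℝ},
      (∀ i, Measurable (ξs i)) → (∀ i t, Measurable (Ws i t)) →
      (∀ i, IsBrownianReal (Ws i) P) → ∀ {M₀ : ℝ}, 0 ≤ M₀ →
      (∀ i, BoundedMean P (fun ω => |ξs i ω| ^ (2 : ℝ)) M₀) →
      ∀ {X : Fin N → ℝ≥0 → Ω → ℝ}, IsSolution U V σ P ξs Ws X →
      ∀ {h : ℝ≥0}, 0 < h → (h : ℝ) < h₀ → h ≤ 1 → lam * h ≤ 1 / 2 → ∀ m i,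
        BoundedMean P (fun ω => (X i (gridTime h m) ω - scheme U V σ h ξs Ws m i ω) ^ 2)
          (K * h * (1 + M₀)) := by
  obtain ⟨L, hL, hD⟩ := hUV.exists_dissipativeDrift
  obtain ⟨κ, K₁, h₀, hκ, hK₁, hh₀, hmom⟩ := exists_boundedMean_scheme hUV σ one_le_two
  have hlam := hUV.lam_pos
  have hKV := hUV.KV_pos
  set A := 2 * KV / lam with hA
  have hA0 : 0 ≤ A := by positivity
  -- the bound for the second moment of the drift along the scheme, up to the factor `1 + M₀`
  set Cb : ℝ := 2 * ((L + KV) ^ 2 * 2 * ((1 + 1) * K₁) + |deriv U 0| ^ 2) with hCb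
  set C : ℝ := 1 / lam * ((1 + A) * ((L + KV) ^ 2 * 2 * ((1 + 1)
    * (3 * ((σ / 2) ^ 2 + Cb + σ ^ 2))))) with hC
  have hC0 : 0 ≤ C := by positivity
  refine ⟨2 * (C / (lam / 4)) + σ ^ 2 + 1, h₀, by positivity, hh₀, ?_⟩
  intro Ω _ P _ N hN ξs Ws hξm hWm hW M₀ hM₀ hξ X hX h hh hhh₀ hh1 hlamh m i
  have hhr : (0 : ℝ) < h := by exact_mod_cast hh
  have hh1r : (h : ℝ) ≤ 1 := by exact_mod_cast hh1
  have hSm := measurable_scheme hUV (σ := σ) (h := h) hξm hWm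
  have hIm : ∀ m j, Measurable (increment h (Ws j) m) := fun m j => measurable_increment (hWm j) m
  have hS : ∀ m j, BoundedMean P (fun ω => |scheme U V σ h ξs Ws m j ω| ^ (2 : ℝ))
      (K₁ * (1 + M₀)) := fun m j => by
    refine (hmom P hN hξm hWm (fun i => (hW i).toIsPreBrownianReal) hM₀ hξ hhh₀ hh1
      hlamh m j).le ?_
    have : Real.exp (-κ * (gridTime h m : ℝ)) ≤ 1 :=
      Real.exp_le_one_iff.2 (by have := (gridTime h m).2; nlinarith [mul_nonneg hκ.le this])
    gcongr
    exact mul_le_of_le_one_right hM₀ this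
  have hb : ∀ m j, BoundedMean P
      (fun ω => drift U V (fun k => scheme U V σ h ξs Ws m k ω) j ^ 2) (Cb * (1 + M₀)) := by
    intro m j
    refine ((((BoundedMean.lyap hN zero_le_one (hS m) j).const_mul
      (a := (L + KV) ^ 2 * 2) (by positivity)).add
      (BoundedMean.const (|deriv U 0| ^ 2))).const_mul zero_le_two).le ?_ |>.mono ?_
      (fun ω => sq_nonneg _) (Filter.Eventually.of_forall fun ω => ?_)
    · rw [hCb]
      nlinarith [mul_nonneg (sq_nonneg |deriv U 0|) hM₀]
    · exact (((continuous_drift hUV j).measurable.comp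
        (measurable_pi_lambda _ (hSm m))).pow_const 2).aestronglyMeasurable
    · have h1 := hD.abs_rpow_le hUV.even_V hlam hL hKV.le hN one_le_two
        (fun k => scheme U V σ h ξs Ws m k ω) j
      rw [show (2 : ℝ) - 1 = 1 by norm_num, Real.rpow_one] at h1
      simpa only [Real.rpow_two, sq_abs] using h1
  choose R hR hRe using fun (m : ℕ) (j : Fin N) =>
    exists_boundedMean_integral_sq (hWm j) (hW j) (gridTime_mono h m)
  -- the scheme corrected by half an increment evolves by full increments of the noise
  let e : ℕ → Fin N → Ω → ℝ := fun m j ω => X j (gridTime h m) ω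
    - (scheme U V σ h ξs Ws m j ω + σ / 2 * increment h (Ws j) m ω)
  have hem : ∀ m j, AEMeasurable (e m j) P := fun m j => by
    have h1 := hX.aemeasurable j (gridTime h m)
    have h2 := (hSm m j).aemeasurable (μ := P)
    have h3 := (hIm m j).aemeasurable (μ := P)
    simp only [e]
    fun_prop
  let q : ℕ → Fin N → Ω → ℝ := fun m k ω =>
    3 * (h * ((σ / 2 * increment h (Ws k) m ω) ^ 2
      + (h : ℝ) ^ 2 * drift U V (fun l => scheme U V σ h ξs Ws m l ω) k ^ 2) + σ ^ 2 * R m k ω)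
  have hq : ∀ m k, BoundedMean P (q m k)
      (3 * ((σ / 2) ^ 2 + Cb + σ ^ 2) * ((h : ℝ) ^ 2 * (1 + M₀))) := by
    intro m k
    have h1 := (boundedMean_increment_sq (hW k).toIsPreBrownianReal h m).const_mul
      (sq_nonneg (σ / 2))
    simp only [← mul_pow] at h1
    have hRk := hR m k
    rw [coe_gridTime_succ, add_sub_cancel_left] at hRk
    refine ((((h1.add ((hb m k).const_mul (sq_nonneg (h : ℝ)))).const_mul hhr.le).add
      (hRk.const_mul (sq_nonneg σ))).const_mul (a := 3) (by norm_num)).le ?_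
    have h2 : (h : ℝ) ^ 3 ≤ (h : ℝ) ^ 2 := pow_le_pow_of_le_one hhr.le hh1r (by norm_num)
    have h3 : (h : ℝ) ^ 3 * (Cb * (1 + M₀)) ≤ (h : ℝ) ^ 2 * (Cb * (1 + M₀)) := by gcongr
    have h4 : 0 ≤ ((σ / 2) ^ 2 + σ ^ 2) * ((h : ℝ) ^ 2 * M₀) := by positivity
    nlinarith
  have hstep : ∀ m, ∀ᵐ ω ∂P, lyap A (fun j => e (m + 1) j ω ^ 2) i
      ≤ (1 - lam / 4 * h) * lyap A (fun j => e m j ω ^ 2) i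
        + h * (1 / h * (1 / lam * lyap A (fun j => (L + KV) ^ 2 * 2
          * lyap 1 (fun k => q m k ω) j) i)) := by
    intro m
    have hWc : ∀ᵐ ω ∂P, ∀ j, Continuous (Ws j · ω) := ae_all_iff.2 fun j => (hW j).cont
    have hRe' : ∀ᵐ ω ∂P, ∀ j, ∫ t in (gridTime h m : ℝ)..gridTime h (m + 1),
        (Ws j t.toNNReal ω - Ws j (gridTime h m) ω) ^ 2 = R m j ω := ae_all_iff.2 fun j => hRe m j
    filter_upwards [hX.continuous, hX.equation, hWc, hRe'] with ω hXc hXe hWc hR'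
    have htn : Continuous Real.toNNReal := continuous_real_toNNReal
    have hxc : ∀ j, Continuous fun t : ℝ => X j t.toNNReal ω := fun j => (hXc j).comp htn
    have hdc : ∀ j, Continuous fun s : ℝ => drift U V (fun k => X k s.toNNReal ω) j := fun j =>
      (continuous_drift hUV j).comp (continuous_pi hxc)
    have hle : (gridTime h m : ℝ) ≤ gridTime h (m + 1) := by exact_mod_cast gridTime_mono h m
    have hmain := lyap_error_step_le hUV hL hD hN (σ := σ) hle hxc
      (fun j => (hWc j).comp htn)
      (fun j => scheme U V σ h ξs Ws m j ω) (fun j => σ / 2 * increment h (Ws j) m ω)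
      (fun t ht j => by
        have h1 := hXe j t.toNNReal
        have h2 := hXe j (gridTime h m)
        rw [Real.coe_toNNReal t ((gridTime h m).2.trans ht.1),
          ← intervalIntegral.integral_add_adjacent_intervals
            ((hdc j).intervalIntegrable 0 (gridTime h m))
            ((hdc j).intervalIntegrable _ _)] at h1
        simp only [Function.comp, Real.toNNReal_coe]
        rw [h1, h2]
        ring) i
    simp only [Function.comp, Real.toNNReal_coe, hR'] at hmain
    rw [show (gridTime h (m + 1) : ℝ) - gridTime h m = h by
      rw [coe_gridTime_succ, add_sub_cancel_left]] at hmain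
    have he1 : ∀ j, e (m + 1) j ω = X j (gridTime h (m + 1)) ω
        - (scheme U V σ h ξs Ws m j ω + σ / 2 * increment h (Ws j) m ω
          + h * drift U V (fun k => scheme U V σ h ξs Ws m k ω) j
          + σ * (Ws j (gridTime h (m + 1)) ω - Ws j (gridTime h m) ω)) := fun j => by
      simp only [e, scheme]
      rw [show increment h (Ws j) (m + 1) ω
        = Ws j (gridTime h (m + 1)) ω - Ws j (gridTime h m) ω from rfl]
      ring
    simp only [he1]
    refine hmain.trans ?_
    rw [← mul_assoc (h : ℝ), mul_one_div_cancel hhr.ne', one_mul]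
    refine add_le_add_left (mul_le_mul_of_nonneg_right ?_
      (lyap_nonneg hA0 (fun j => sq_nonneg _) i)) _
    -- `exp (-y) ≤ 1 / (1 + y) ≤ 1 - y / 2` for `0 ≤ y ≤ 1`
    set y := lam / 2 * (h : ℝ) with hy
    have hy0 : 0 ≤ y := by positivity
    have h1 : Real.exp (-y) ≤ 1 / (1 + y) := by
      rw [Real.exp_neg, ← one_div]
      exact one_div_le_one_div_of_le (by positivity) (by linarith [Real.add_one_le_exp y])
    have h2 : 1 / (1 + y) ≤ 1 - y / 2 := by
      rw [div_le_iff₀ (by positivity)]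
      nlinarith
    linarith
  have hφ := BoundedMean.recursion (P := P) (φ := fun m ω => lyap A (fun j => e m j ω ^ 2) i)
    (G := fun m ω => 1 / h * (1 / lam * lyap A (fun j => (L + KV) ^ 2 * 2
          * lyap 1 (fun k => q m k ω) j) i))
    (κ := lam / 4) (h := h) (c₀ := 0) (C := C * (h * (1 + M₀))) (by positivity) hhr.le
    (by linarith) (by positivity)
    (fun m => by
      have := hem m
      simp only [lyap, avg]
      exact AEMeasurable.aestronglyMeasurable (by fun_prop))
    (fun m ω => lyap_nonneg hA0 (fun j => sq_nonneg _) i)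
    (by
      refine (BoundedMean.const (P := P) 0).mono ?_
        (fun ω => lyap_nonneg hA0 (fun j => sq_nonneg _) i) ?_
      · have := hem 0
        simp only [lyap, avg]
        exact AEMeasurable.aestronglyMeasurable (by fun_prop)
      · have hW0 : ∀ᵐ ω ∂P, ∀ j, Ws j 0 ω = 0 :=
          ae_all_iff.2 fun j => (hW j).eval_zero_ae_eq_zero
        filter_upwards [hX.equation, hW0] with ω hXe hW0
        have : ∀ j, e 0 j ω = 0 := fun j => by
          have h1 := hXe j 0
          simp only [e, gridTime, scheme, increment]
          simpa [hW0 j, sub_eq_zero] using h1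
        simp [this, lyap, avg])
    (fun m => by
      refine ((((BoundedMean.lyap hN hA0 (fun j => (BoundedMean.lyap hN zero_le_one
        (hq m) j).const_mul (a := (L + KV) ^ 2 * 2) (by positivity)) i).const_mul
        (a := 1 / lam) (by positivity)).const_mul (a := 1 / (h : ℝ)) (by positivity))).le
        (le_of_eq ?_)
      rw [hC]
      field_simp)
    hstep m
  have hfin := (hφ.const_mul (a := 2) zero_le_two).add
    ((boundedMean_increment_sq (hW i).toIsPreBrownianReal h m).const_mul
      (a := 2 * (σ / 2) ^ 2) (by positivity))
  refine hfin.le ?_ |>.mono ?_ (fun ω => sq_nonneg _) (Filter.Eventually.of_forall fun ω => ?_)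
  · have h1 : 0 ≤ (σ ^ 2 / 2 + 1) * h + (σ ^ 2 + 1) * (h * M₀) := by positivity
    rw [mul_zero, zero_add, mul_div_right_comm]
    nlinarith
  · have h1 := hX.aemeasurable i (gridTime h m)
    have h2 := (hSm m i).aemeasurable (μ := P)
    exact AEMeasurable.aestronglyMeasurable (by fun_prop)
  · have h1 := le_lyap hA0 (x := fun j => e m j ω ^ 2) (fun j => sq_nonneg _) i
    have h2 : X i (gridTime h m) ω - scheme U V σ h ξs Ws m i ω
        = e m i ω + σ / 2 * increment h (Ws i) m ω := by simp only [e]; ring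
    rw [h2]
    exact sq_add_mul_le h1 _ _

/-! ### Passing to i.i.d. copies -/

lemma IsIIDCopies.boundedMean_init {Ω₀ : Type*} [MeasurableSpace Ω₀] {P₀ : Measure Ω₀}
    [IsProbabilityMeasure P₀] {ξ : Ω₀ → ℝ} {W : ℝ≥0 → Ω₀ → ℝ} {Ω : Type*} [MeasurableSpace Ω]
    {P : Measure Ω} {ξs : Fin N → Ω → ℝ} {Ws : Fin N → ℝ≥0 → Ω → ℝ}
    (hc : IsIIDCopies P₀ ξ W P ξs Ws) {p q : ℝ} (hp : 0 < p) (hpq : p ≤ q)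
    (hξ : MemLp ξ (ENNReal.ofReal q) P₀) (i : Fin N) :
    BoundedMean P (fun ω => |ξs i ω| ^ p) (∫ ω, |ξ ω| ^ p ∂P₀) := by
  have hid : IdentDistrib (fun ω => |ξs i ω| ^ p) (fun ω => |ξ ω| ^ p) P P₀ :=
    (hc.identDistrib i).comp (u := fun z : ℝ × (ℝ≥0 → ℝ) => |z.1| ^ p) (by fun_prop)
  have hint : Integrable (fun ω => |ξ ω| ^ p) P₀ := by
    have h1 : MemLp ξ (ENNReal.ofReal p) P₀ := hξ.mono_exponent (ENNReal.ofReal_le_ofReal hpq)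
    simpa [ENNReal.toReal_ofReal hp.le] using h1.integrable_norm_rpow (by simpa using hp) (by simp)
  exact ⟨hid.integrable_iff.2 hint, hid.integral_eq.le⟩

end

end ParticleSystem

theorem proposition2p2 (U V : ℝ → ℝ) (lam KV : ℝ)
    (hUV : ParticleSystem.Potentials U V lam KV) (σ : ℝ) (p : ℝ) (hp : 2 ≤ p) :
    -- uniform-in-time moment bounds
    (∃ κ K h₀ : ℝ, 0 < κ ∧ 0 < K ∧ 0 < h₀ ∧
      ∀ (Ω₀ : Type*) [MeasurableSpace Ω₀] (P₀ : Measure Ω₀) [IsProbabilityMeasure P₀]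
        (ξ : Ω₀ → ℝ) (W : ℝ≥0 → Ω₀ → ℝ),
        ParticleSystem.IsInput P₀ ξ W → MemLp ξ (ENNReal.ofReal p) P₀ →
      ∀ (N : ℕ), 1 ≤ N → ∀ (Ω : Type*) [MeasurableSpace Ω] (P : Measure Ω)
        [IsProbabilityMeasure P] (ξs : Fin N → Ω → ℝ) (Ws : Fin N → ℝ≥0 → Ω → ℝ),
        ParticleSystem.IsIIDCopies P₀ ξ W P ξs Ws →
      ∀ (M : ℕ) (h : ℝ≥0), 0 < h → (h : ℝ) < h₀ → (h : ℝ) < min (1 / (2 * lam)) 1 →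
      ∀ m : ℕ, m ≤ M → ∀ i : Fin N,
        MemLp (ParticleSystem.scheme U V σ h ξs Ws m i) (ENNReal.ofReal p) P ∧
        ∫ ω, |ParticleSystem.scheme U V σ h ξs Ws m i ω| ^ p ∂P
          ≤ K * (1 + (∫ ω, |ξ ω| ^ p ∂P₀)
              * Real.exp (-κ * (ParticleSystem.gridTime h m : ℝ)))) ∧
    -- uniform-in-time strong error
    (∃ K h₀ : ℝ, 0 < K ∧ 0 < h₀ ∧
      ∀ (Ω₀ : Type*) [MeasurableSpace Ω₀] (P₀ : Measure Ω₀) [IsProbabilityMeasure P₀]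
        (ξ : Ω₀ → ℝ) (W : ℝ≥0 → Ω₀ → ℝ),
        ParticleSystem.IsInput P₀ ξ W → MemLp ξ (ENNReal.ofReal p) P₀ →
      ∀ (N : ℕ), 1 ≤ N → ∀ (Ω : Type*) [MeasurableSpace Ω] (P : Measure Ω)
        [IsProbabilityMeasure P] (ξs : Fin N → Ω → ℝ) (Ws : Fin N → ℝ≥0 → Ω → ℝ),
        ParticleSystem.IsIIDCopies P₀ ξ W P ξs Ws →
      ∀ X : Fin N → ℝ≥0 → Ω → ℝ, ParticleSystem.IsSolution U V σ P ξs Ws X →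
      ∀ (M : ℕ) (h : ℝ≥0), 0 < h → (h : ℝ) < h₀ → (h : ℝ) < min (1 / (2 * lam)) 1 →
      ∀ m : ℕ, m ≤ M → ∀ i : Fin N,
        MemLp (fun ω => X i (ParticleSystem.gridTime h m) ω
          - ParticleSystem.scheme U V σ h ξs Ws m i ω) 2 P ∧
        ∫ ω, |X i (ParticleSystem.gridTime h m) ω
            - ParticleSystem.scheme U V σ h ξs Ws m i ω| ^ 2 ∂P
          ≤ K * h * (1 + ∫ ω, |ξ ω| ^ 2 ∂P₀)) := by

  have hlam := hUV.lam_pos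
  have hsmall : ∀ {h : ℝ≥0}, (h : ℝ) < min (1 / (2 * lam)) 1 → h ≤ 1 ∧ lam * h ≤ 1 / 2 := by
    intro h hh
    have h1 := hh.trans_le (min_le_left _ _)
    have h2 := hh.trans_le (min_le_right _ _)
    rw [lt_div_iff₀ (by positivity)] at h1
    exact ⟨by exact_mod_cast h2.le, by linarith⟩
  constructor
  · obtain ⟨κ, K, h₀, hκ, hK, hh₀, H⟩ :=
      ParticleSystem.exists_boundedMean_scheme hUV σ (p := p) (by linarith)
    refine ⟨κ, K, h₀, hκ, hK, hh₀, ?_⟩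
    intro Ω₀ _ P₀ _ ξ W _ hξ N hN Ω _ P _ ξs Ws hc M h _ hhh₀ hh m _ i
    have hm := H P hN (fun i => (hc.input i).measurable_init)
      (fun i => (hc.input i).measurable_noise)
      (fun i => (hc.input i).brownian.toIsPreBrownianReal)
      (integral_nonneg fun ω => Real.rpow_nonneg (abs_nonneg (ξ ω)) p)
      (hc.boundedMean_init (by linarith) le_rfl hξ) hhh₀ (hsmall hh).1 (hsmall hh).2 m i
    refine ⟨?_, hm.2⟩
    have hmeas := ParticleSystem.measurable_scheme hUV (σ := σ) (h := h)
      (fun i => (hc.input i).measurable_init) (fun i => (hc.input i).measurable_noise) m i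
    rw [← integrable_norm_rpow_iff hmeas.aestronglyMeasurable
      (by simp; linarith) (by simp), ENNReal.toReal_ofReal (by linarith)]
    exact hm.1
  · obtain ⟨K, h₀, hK, hh₀, H⟩ := ParticleSystem.exists_boundedMean_error hUV σ
    refine ⟨K, h₀, hK, hh₀, ?_⟩
    intro Ω₀ _ P₀ _ ξ W _ hξ N hN Ω _ P _ ξs Ws hc X hX M h hpos hhh₀ hh m _ i
    have hm := H P hN (fun i => (hc.input i).measurable_init)
      (fun i => (hc.input i).measurable_noise) (fun i => (hc.input i).brownian)
      (integral_nonneg fun ω => Real.rpow_nonneg (abs_nonneg (ξ ω)) 2)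
      (hc.boundedMean_init two_pos hp hξ) hX hpos hhh₀ (hsmall hh).1 (hsmall hh).2 m i
    simp only [Real.rpow_two] at hm
    have hmeas := (hX.aemeasurable i (ParticleSystem.gridTime h m)).sub
      (ParticleSystem.measurable_scheme hUV (σ := σ) (h := h)
        (fun i => (hc.input i).measurable_init)
        (fun i => (hc.input i).measurable_noise) m i).aemeasurable
    refine ⟨(memLp_two_iff_integrable_sq hmeas.aestronglyMeasurable).2 hm.1, ?_⟩
    simp only [sq_abs] at hm ⊢
    exact hm.2
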